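/- For \(\mu,z\in\mathbb C\), \(z\neq 0\), with the principal logarithm (\(-\pi<\arg z\le\pi\)), let \[ J_\mu(z)=\Big(\frac z2\Big)^{\mu}\sum_{k\ge 0}\frac{(-1)^k (z/2)^{2k}}{k!\,\Gamma(\mu+k+1)},\qquad Y_\mu(z)=\frac{J_\mu(z)\cos\mu\pi-J_{-\mu}(z)}{\sin\mu\pi}\ (\mu\notin\mathbb Z),\qquad Y_m(z)=\lim_{\mu\to m}Y_\mu(z)\ (m\in\mathbb Z), \] where \(1/\Gamma\) is read as \(0\) at the poles of \(\Gamma\). Let \(\Gamma(0,w)=\int_w^\infty e^{-t}\,\frac{dt}{t}\) be the upper incomplete gamma function, a multivalued analytic function of \(w\neq0\) whose principal branch is defined for \(w\in\mathbb C\setminus(-\infty,0]\). For \(m\in\mathbb Z\) and \(z\ne 0\) let \[ \sigma_m(z)=\frac{(-1)^m}{\sqrt\pi}\,e^{iz}\sum_{j=1}^{|m|}\frac{\Gamma(\frac12-j)\,\Gamma(j+|m|)}{\Gamma(|m|-j+1)}\,(2iz)^{-j}, \] the sum being \(0\) if \(m=0\). Then for every \(m\in\mathbb Z\) and every \(z\in\mathbb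 C\setminus\{0\}\) the limit defining \(Y_m(z)\) exists, the following integrals converge absolutely, and \[ Y_m(z)=-\frac{2\,i^m}{\pi}\left\{\frac1\pi\int_0^\pi e^{-iz\cos\theta}\Big[\Gamma\big(0,-iz(1+\cos\theta)\big)-\frac{i\pi}{2}\Big]\cos m\theta\,d\theta+\sigma_m(z)\right\}, \] where \(\Gamma(0,-iz(1+\cos\theta))\) is the value obtained by analytic continuation of the principal branch from \(w=1\) to the point \(w=-iz(1+\cos\theta)\) of the Riemann surface of the logarithm with \(\arg w=\arg z-\frac{\pi}{2}\). If \(-\frac\pi2<\arg z\le\pi\), this is the value of the principal branch, so the formula then holds with the principal branch of \(\Gamma(0,\cdot)\). In particular, with the same branches, \[ Y_0(z)=\frac{2}{\pi^2}\int_0^\pi e^{-iz\cos\theta}\Big[\frac{i\pi}{2}-\Gamma\big(0,-iz(1+\cos\theta)\big)\Big]d\theta . \] -/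

import Mathlib

open Filter Topology

noncomputable section

/-- The Bessel function of the first kind,
`J_μ(z) = (z/2)^μ ∑_{k ≥ 0} (-1)^k (z/2)^{2k} / (k! Γ(μ+k+1))`, with the principal power.
Mathlib's conventions `Γ(-n) = 0` and `x / 0 = 0` give `1/Γ(-n) = 0`, which is the value of the
entire function `1/Γ` at `-n`. -/
def besselJ (μ z : ℂ) : ℂ :=
  (z / 2) ^ μ *
    ∑' k : ℕ, (-1) ^ k * (z / 2) ^ (2 * k) / ((k.factorial : ℂ) * Complex.Gamma (μ + k + 1))

/-- The defining quotient of the Bessel function of the second kind at non-integer order. -/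
def besselYQuotient (μ z : ℂ) : ℂ :=
  (besselJ μ z * Complex.cos (μ * Real.pi) - besselJ (-μ) z) / Complex.sin (μ * Real.pi)

open scoped Classical in
/-- The Bessel function of the second kind (Neumann's function): the quotient
`(J_μ(z) cos μπ - J_{-μ}(z)) / sin μπ` if `μ` is not an integer, and the limit of this quotient
along the non-integer orders tending to `μ` if `μ` is an integer. -/
def besselY (μ z : ℂ) : ℂ :=
  if μ ∈ Set.range (fun n : ℤ => (n : ℂ)) then
    limUnder (𝓝[≠] μ) (fun ν => besselYQuotient ν z)
  else besselYQuotient μ z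

/-- The principal branch of the upper incomplete gamma function,
`Γ(a,w) = ∫_w^∞ u^{a-1} e^{-u} du` for `w ∈ ℂ \ (-∞,0]`, the path of integration being the
horizontal ray `u = w + t`, `t > 0`, which does not meet the cut `(-∞,0]`. -/
def upperGamma (a w : ℂ) : ℂ :=
  ∫ t in Set.Ioi (0 : ℝ), (w + t) ^ (a - 1) * Complex.exp (-(w + t))

/-- The analytic continuation of the upper incomplete gamma function to the Riemann surface of the
logarithm, as a function of the logarithm `ζ` of its argument: the value of `Γ(a,w)` at the point
`w = e^ζ` with `arg w = Im ζ`. It is `Γ(a,1) - ∫_1^w u^{a-1} e^{-u} du`, where `u = e^{sζ}`,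
`0 ≤ s ≤ 1`, runs from `1` to `w` with `arg u = s Im ζ`. -/
def upperGammaOfLog (a ζ : ℂ) : ℂ :=
  upperGamma a 1 - ζ * ∫ s in (0 : ℝ)..1, Complex.exp (a * (s * ζ) - Complex.exp (s * ζ))

/-- The finite sum
`σ_m(z) = (-1)^m π^{-1/2} e^{iz} ∑_{j=1}^{|m|} Γ(1/2-j) Γ(j+|m|) / Γ(|m|-j+1) (2iz)^{-j}`. -/
def neumannSum (m : ℤ) (z : ℂ) : ℂ :=
  (-1) ^ m / (Real.sqrt Real.pi : ℂ) * Complex.exp (Complex.I * z) *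
    ∑ j ∈ Finset.Icc 1 m.natAbs,
      Complex.Gamma (1 / 2 - (j : ℂ)) * Complex.Gamma ((j : ℂ) + (m.natAbs : ℂ)) /
          Complex.Gamma ((m.natAbs : ℂ) - (j : ℂ) + 1) *
        (2 * Complex.I * z) ^ (-(j : ℤ))

/-- The value of `Γ(0, -iz(1 + cos θ))` on the branch with
`arg (-iz(1 + cos θ)) = arg z - π/2`, where `-π < arg z ≤ π` (relevant for `-π < θ < π`). -/
def gammaZeroBranch (z : ℂ) (θ : ℝ) : ℂ :=
  upperGammaOfLog 0
    (Complex.log z - Complex.I * (Real.pi / 2) + (Real.log (1 + Real.cos θ) : ℂ))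

end

/-! At an integer order the quotient defining Y is 0/0, so Y_m is 1/π times the sum of the order
derivative of J at m and (-1)^m times the order derivative of J at -m. The proof recognises this sum
as a single exponent derivative of a Frobenius series whose coefficients are moments of powers of 1
+ cos θ.

Kummer's second transformation (`exp_mul_kummerSum_eventuallyEq`) writes J_μ(z) as e^{iz} e^{iπμ/2}
times the sum of (-2iz)^{n+μ} Γ(n+μ+1/2) / (√π n! Γ(n+2μ+1)). Instead of varying μ near m and near
-m separately, one shifts the exponent by s in the series for -m and uses the denominators Γ(n+s+1)
Γ(n+s-2m+1). By the product rule, twice the s-derivative at 0 is the sum of the two order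
derivatives (`two_mul_tsum_deriv_frobeniusTerm`).

For n = k + m the shifted term is (-iz)^{k+s} / Γ(k+s+1) times 1/π times the integral over [0, π] of
(1 + cos θ)^{k+s} cos mθ (`cosineMoment_eq`, `frobeniusTerm_add_eq`). Its derivative at s = 0 brings
in log(-iz) + γ - H_k and log(1 + cos θ). Up to sign these are the coefficients in Γ(0,w) = -γ - log
w + e^{-w} ∑ H_k w^k / k! at w = -iz(1 + cos θ), and e^{iz} e^w = e^{-iz cos θ}. Summation under the
integral sign (`hasSum_integral_branch`) therefore gives the integral in the statement. The constant
-γ comes from Γ'(1) (`upperGamma_zero_one_sub`).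

The terms with n < m vanish at s = 0, but their derivatives do not, because 1/Γ has simple zeros;
they make up the finite sum (`neumannSum_natCast`). Negative orders follow by reflection. -/

noncomputable section

/-! ### Termwise differentiation of series with a two-term recurrence -/

/-- A series of holomorphic functions on a disc whose terms eventually decay geometrically is
dominated by a convergent numerical series on the disc of half the radius. -/
theorem exists_summable_bound_of_ratio {F : ℕ → ℂ → ℂ} {c : ℂ} {R : ℝ}
    (hR : 0 < R) (hF : ∀ n, DifferentiableOn ℂ (F n) (Metric.ball c R)) {N : ℕ}
    (h : ∀ n ≥ N, ∀ w ∈ Metric.ball c R, ‖F (n + 1) w‖ ≤ 1 / 2 * ‖F n w‖) :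
    ∃ u : ℕ → ℝ, Summable u ∧ ∀ n, ∀ w ∈ Metric.ball c (R / 2), ‖F n w‖ ≤ u n := by
  have hsub : Metric.closedBall c (R / 2) ⊆ Metric.ball c R :=
    Metric.closedBall_subset_ball (by linarith)
  have hM : ∀ n, ∃ M, ∀ w ∈ Metric.closedBall c (R / 2), ‖F n w‖ ≤ M := fun n =>
    (isCompact_closedBall c (R / 2)).exists_bound_of_continuousOn ((hF n).continuousOn.mono hsub)
  choose M hM using hM
  refine ⟨fun n => if n < N then M n else M N * (1 / 2) ^ (n - N), ?_, ?_⟩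
  · rw [← summable_nat_add_iff N]
    simp only [not_lt.mpr (Nat.le_add_left _ _), if_false, Nat.add_sub_cancel]
    exact (summable_geometric_two).mul_left _
  · intro n w hw
    have hw' := Metric.ball_subset_closedBall hw
    dsimp only
    split_ifs with hn
    · exact hM n w hw'
    · obtain ⟨k, rfl⟩ := Nat.exists_eq_add_of_le (not_lt.mp hn)
      rw [Nat.add_sub_cancel_left]
      clear hn
      induction k with
      | zero => simpa using hM N w hw'
      | succ k ih =>
        have := h (N + k) (Nat.le_add_right _ _) w (hsub hw')
        rw [← add_assoc, pow_succ]
        linarith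

/-- Termwise differentiation of a series of holomorphic functions satisfying a two-term recurrence
`(n + a)(n + b) F_{n+1} = g F_n`, where `a`, `b` are bounded and `g` grows at most linearly. -/
theorem hasSum_deriv_of_recurrence {F a b g : ℕ → ℂ → ℂ} {c : ℂ} {R M W : ℝ}
    (hR : 0 < R) (hF : ∀ n, DifferentiableOn ℂ (F n) (Metric.ball c R)) (N₀ : ℕ)
    (hW : 0 ≤ W) (ha : ∀ n, ∀ w ∈ Metric.ball c R, ‖a n w‖ ≤ M)
    (hb : ∀ n, ∀ w ∈ Metric.ball c R, ‖b n w‖ ≤ M)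
    (hg : ∀ n, ∀ w ∈ Metric.ball c R, ‖g n w‖ ≤ W * (n + M))
    (hrec : ∀ n ≥ N₀, ∀ w ∈ Metric.ball c R,
      ((n : ℂ) + a n w) * (n + b n w) * F (n + 1) w = g n w * F n w) :
    (∀ w ∈ Metric.ball c (R / 2), Summable fun n => ‖F n w‖) ∧
      DifferentiableAt ℂ (fun w => ∑' n, F n w) c ∧
      HasSum (fun n => deriv (F n) c) (deriv (fun w => ∑' n, F n w) c) := by
  have hM0 : 0 ≤ M := (norm_nonneg _).trans (ha 0 c (Metric.mem_ball_self hR))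
  -- For n ≥ 2M both linear factors have norm at least n/2. With n ≥ 16W also W(n + M) ≤ (3/2)Wn ≤
  -- 3n²/32, below the n²/8 needed for ratio 1/2.
  obtain ⟨K, hK⟩ := exists_nat_ge (2 * M + 16 * W + 1)
  have hratio : ∀ n ≥ max K N₀, ∀ w ∈ Metric.ball c R, ‖F (n + 1) w‖ ≤ 1 / 2 * ‖F n w‖ := by
    intro n hn w hw
    have hn' : 2 * M + 16 * W + 1 ≤ (n : ℝ) :=
      hK.trans (by exact_mod_cast (le_max_left _ _).trans hn)
    have key := congrArg norm (hrec n ((le_max_right _ _).trans hn) w hw)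
    rw [norm_mul, norm_mul, norm_mul] at key
    have lower : ∀ x : ℂ, ‖x‖ ≤ M → (n : ℝ) / 2 ≤ ‖(n : ℂ) + x‖ := by
      intro x hx
      have := norm_sub_le ((n : ℂ) + x) x
      rw [add_sub_cancel_right, Complex.norm_natCast] at this
      linarith
    have h1 := lower _ (ha n w hw)
    have h2 := lower _ (hb n w hw)
    have h3 := hg n w hw
    have hn0 : (0 : ℝ) < n := by linarith
    have h4 : (n : ℝ) / 2 * (n / 2) * ‖F (n + 1) w‖ ≤ W * (n + M) * ‖F n w‖ := by
      calc _ ≤ ‖(n : ℂ) + a n w‖ * ‖(n : ℂ) + b n w‖ * ‖F (n + 1) w‖ := by gcongr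
        _ = _ := key
        _ ≤ _ := by gcongr
    have h5 : W * (n + M) ≤ (n : ℝ) / 2 * (n / 2) * (1 / 2) := by
      nlinarith [mul_nonneg hW hn0.le]
    have h6 : (n : ℝ) / 2 * (n / 2) * ‖F (n + 1) w‖ ≤ (n : ℝ) / 2 * (n / 2) * (1 / 2 * ‖F n w‖) := by
      rw [← mul_assoc]
      exact h4.trans (by gcongr)
    exact le_of_mul_le_mul_left h6 (by positivity)
  obtain ⟨u, hu, hub⟩ := exists_summable_bound_of_ratio hR hF hratio
  have hsub : Metric.ball c (R / 2) ⊆ Metric.ball c R := Metric.ball_subset_ball (by linarith)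
  have hc : c ∈ Metric.ball c (R / 2) := Metric.mem_ball_self (by linarith)
  have hF' : ∀ n, DifferentiableOn ℂ (F n) (Metric.ball c (R / 2)) := fun n => (hF n).mono hsub
  exact ⟨fun w hw => Summable.of_nonneg_of_le (fun _ => norm_nonneg _) (fun n => hub n w hw) hu,
    (Complex.differentiableOn_tsum_of_summable_norm hu hF' Metric.isOpen_ball hub).differentiableAt
      (Metric.isOpen_ball.mem_nhds hc),
    Complex.hasSum_deriv_of_summable_norm hu hF' Metric.isOpen_ball hub hc⟩

/-! ### Reciprocal Gamma function, Kummer series and Frobenius series -/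

/-- The reciprocal Gamma function. -/
def rGamma (x : ℂ) : ℂ := (Complex.Gamma x)⁻¹

theorem differentiable_rGamma : Differentiable ℂ rGamma := Complex.differentiable_one_div_Gamma

theorem rGamma_eq_mul (x : ℂ) : rGamma x = x * rGamma (x + 1) :=
  Complex.one_div_Gamma_eq_self_mul_one_div_Gamma_add_one x

theorem rGamma_neg_nat (n : ℕ) : rGamma (-n) = 0 := by simp [rGamma, Complex.Gamma_neg_nat_eq_zero]

theorem rGamma_nat_add_one (n : ℕ) : rGamma (n + 1) = (n.factorial : ℂ)⁻¹ := by
  simp [rGamma, Complex.Gamma_nat_eq_factorial]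

/-- The principal logarithm of `z` shifted by `-iπ/2`: the logarithm of `-iz`
on the branch `arg (-iz) = arg z - π/2`. -/
def logNegI (z : ℂ) : ℂ := Complex.log z - Complex.I * (Real.pi / 2)

theorem exp_logNegI {z : ℂ} (hz : z ≠ 0) : Complex.exp (logNegI z) = -Complex.I * z := by
  have h : Complex.exp (-(Complex.I * (Real.pi / 2))) = -Complex.I := by
    rw [show -(Complex.I * (Real.pi / 2)) = -Real.pi / 2 * Complex.I by ring,
      Complex.exp_neg_pi_div_two_mul_I]
  rw [logNegI, sub_eq_add_neg, Complex.exp_add, Complex.exp_log hz, h, mul_comm]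

/-- The factor `(-2iz)^x Γ(x + 1/2) / √π`. -/
def hankelFactor (z x : ℂ) : ℂ :=
  Complex.exp (x * (logNegI z + Real.log 2)) * Complex.Gamma (x + 1 / 2) / (Real.sqrt Real.pi : ℂ)

/-- The terms of the expansion of `e^{-iz} e^{-iπμ/2} J_μ(z)` obtained from Kummer's second
transformation. -/
def kummerTerm (z : ℂ) (n : ℕ) (μ : ℂ) : ℂ :=
  hankelFactor z (n + μ) * rGamma (n + 1) * rGamma (n + 2 * μ + 1)

/-- The sum of the series `kummerTerm`. -/
def kummerSum (z μ : ℂ) : ℂ := ∑' n, kummerTerm z n μ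

/-- The terms of the Frobenius series with shifted exponent `s - m`. -/
def frobeniusTerm (z : ℂ) (m n : ℕ) (s : ℂ) : ℂ :=
  hankelFactor z (n - m + s) * rGamma (n + s + 1) * rGamma (n + s - 2 * m + 1)

theorem exp_two_log_add {z : ℂ} (hz : z ≠ 0) :
    Complex.exp (logNegI z + Real.log 2) = -Complex.I * z * 2 := by
  rw [Complex.exp_add, exp_logNegI hz, ← Complex.ofReal_exp, Real.exp_log two_pos]
  simp

theorem hankelFactor_add_one {z : ℂ} (hz : z ≠ 0) {x : ℂ} (hx : x + 1 / 2 ≠ 0) :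
    hankelFactor z (x + 1) = -Complex.I * z * 2 * (x + 1 / 2) * hankelFactor z x := by
  unfold hankelFactor
  rw [show x + 1 + 1 / 2 = x + 1 / 2 + 1 by ring, Complex.Gamma_add_one _ hx, add_mul,
    Complex.exp_add, one_mul, exp_two_log_add hz]
  ring

theorem differentiableAt_hankelFactor (z : ℂ) {x : ℂ} (hx : ∀ n : ℕ, x + 1 / 2 ≠ -n) :
    DifferentiableAt ℂ (hankelFactor z) x := by
  have h := (Complex.differentiableAt_Gamma _ hx)
  have h2 : DifferentiableAt ℂ (fun x : ℂ => Complex.Gamma (x + 1 / 2)) x :=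
    DifferentiableAt.comp x (g := Complex.Gamma) h (by fun_prop)
  unfold hankelFactor
  fun_prop

/-- A number close to an integer is not a half-integer. -/
theorem add_half_ne_of_norm_lt {s : ℂ} (hs : ‖s‖ < 1 / 4) (p q : ℤ) :
    (p : ℂ) + s + 1 / 2 ≠ q := by
  intro h
  have h1 : s = ((q - p - 1 / 2 : ℝ) : ℂ) := by push_cast; linear_combination h
  rw [h1, Complex.norm_real, Real.norm_eq_abs, abs_lt] at hs
  have h2 : (-1 : ℝ) < ((2 * (q - p) - 1 : ℤ) : ℝ) := by push_cast; linarith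
  have h3 : ((2 * (q - p) - 1 : ℤ) : ℝ) < 1 := by push_cast; linarith
  have h4 : (-1 : ℤ) < 2 * (q - p) - 1 := by exact_mod_cast h2
  have h5 : 2 * (q - p) - 1 < (1 : ℤ) := by exact_mod_cast h3
  omega

theorem differentiableAt_hankelFactor_int_add (z : ℂ) (p : ℤ) {s : ℂ} (hs : ‖s‖ < 1 / 4) :
    DifferentiableAt ℂ (hankelFactor z) (p + s) :=
  differentiableAt_hankelFactor z fun n => by
    have := add_half_ne_of_norm_lt hs p (-n)
    simpa using this

/-- Kept free of division so that it survives at the zeros of `rGamma`, in particular at negative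
integer orders, where the leading terms vanish. -/
theorem kummerTerm_rec {z : ℂ} (hz : z ≠ 0) (n : ℕ) {μ : ℂ} (hμ : (n : ℂ) + μ + 1 / 2 ≠ 0) :
    ((n : ℂ) + 1) * (n + (2 * μ + 1)) * kummerTerm z (n + 1) μ =
      -Complex.I * z * 2 * (n + μ + 1 / 2) * kummerTerm z n μ := by
  unfold kummerTerm
  push_cast
  rw [show (n : ℂ) + 1 + μ = n + μ + 1 by ring, hankelFactor_add_one hz hμ,
    rGamma_eq_mul ((n : ℂ) + 1), rGamma_eq_mul ((n : ℂ) + 2 * μ + 1),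
    show (n : ℂ) + 1 + 2 * μ + 1 = n + 2 * μ + 1 + 1 by ring]
  ring

theorem hasSum_deriv_kummerTerm {z : ℂ} (hz : z ≠ 0) (p : ℤ) :
    (∀ w ∈ Metric.ball (p : ℂ) (1 / 4 / 2), Summable fun n => ‖kummerTerm z n w‖) ∧
      DifferentiableAt ℂ (kummerSum z) p ∧
      HasSum (fun n => deriv (kummerTerm z n) p) (deriv (kummerSum z) p) := by
  have hball : ∀ w ∈ Metric.ball (p : ℂ) (1 / 4), ∃ s : ℂ, ‖s‖ < 1 / 4 ∧ w = p + s := by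
    intro w hw
    refine ⟨w - p, by simpa [dist_eq_norm] using hw, by ring⟩
  -- Radius 1/4 keeps n + μ off the half-integers, where the Gamma factor has its poles; M bounds 2μ
  -- + 1 on this disc.
  refine hasSum_deriv_of_recurrence (F := kummerTerm z) (a := fun _ _ => 1)
    (b := fun _ w => 2 * w + 1) (g := fun n w => -Complex.I * z * 2 * (n + w + 1 / 2))
    (c := (p : ℂ)) (R := 1 / 4) (M := 2 * ‖(p : ℂ)‖ + 2) (W := ‖z‖ * 2)
    (by norm_num) ?_ 0 (by positivity) ?_ ?_ ?_ ?_
  · intro n w hw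
    obtain ⟨s, hs, rfl⟩ := hball w hw
    refine DifferentiableAt.differentiableWithinAt ?_
    have h1 : DifferentiableAt ℂ (fun μ : ℂ => hankelFactor z (n + μ)) (p + s) := by
      refine DifferentiableAt.comp (p + s) (g := hankelFactor z) ?_ (by fun_prop)
      have := differentiableAt_hankelFactor_int_add z (n + p) hs
      push_cast at this
      rwa [add_assoc] at this
    have h2 := differentiable_rGamma
    unfold kummerTerm
    fun_prop
  · intro n w _
    simp only [norm_one]
    linarith [norm_nonneg (p : ℂ)]
  · intro n w hw
    obtain ⟨s, hs, rfl⟩ := hball w hw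
    have h1 : ‖(p : ℂ) + s‖ ≤ ‖(p : ℂ)‖ + ‖s‖ := norm_add_le _ _
    have h2 : ‖2 * ((p : ℂ) + s) + 1‖ ≤ 2 * ‖(p : ℂ) + s‖ + 1 := by
      refine (norm_add_le _ _).trans ?_
      simp
    linarith
  · intro n w hw
    obtain ⟨s, hs, rfl⟩ := hball w hw
    have h1 : ‖(n : ℂ) + (p + s) + 1 / 2‖ ≤ n + (‖(p : ℂ)‖ + ‖s‖) + 1 / 2 := by
      refine (norm_add_le _ _).trans ?_
      gcongr
      · refine (norm_add_le _ _).trans ?_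
        rw [Complex.norm_natCast]
        gcongr
        exact norm_add_le _ _
      · norm_num
    simp only [norm_mul, norm_neg, Complex.norm_I, one_mul, Complex.norm_ofNat]
    gcongr
    linarith [norm_nonneg (p : ℂ)]
  · intro n _ w hw
    obtain ⟨s, hs, rfl⟩ := hball w hw
    refine kummerTerm_rec hz n ?_
    have := add_half_ne_of_norm_lt hs (n + p) 0
    push_cast at this
    rwa [add_assoc (n : ℂ)] at this

theorem hasSum_deriv_frobeniusTerm {z : ℂ} (hz : z ≠ 0) (m : ℕ) :
    (Summable fun n => ‖frobeniusTerm z m n 0‖) ∧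
      HasSum (fun n => deriv (frobeniusTerm z m n) 0)
        (deriv (fun s => ∑' n, frobeniusTerm z m n s) 0) := by
  have hball : ∀ w ∈ Metric.ball (0 : ℂ) (1 / 4), ‖w‖ < 1 / 4 := by
    intro w hw
    simpa [dist_eq_norm] using hw
  refine (fun h => ⟨h.1 0 (Metric.mem_ball_self (by norm_num)), h.2.2⟩) (hasSum_deriv_of_recurrence (F := frobeniusTerm z m)
    (a := fun _ w => w + 1)
    (b := fun _ w => w - 2 * m + 1) (g := fun n w => -Complex.I * z * 2 * (n - m + w + 1 / 2))
    (c := 0) (R := 1 / 4) (M := 2 * m + 2) (W := ‖z‖ * 2)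
    (by norm_num) ?_ 0 (by positivity) ?_ ?_ ?_ ?_)
  · intro n s hs
    refine DifferentiableAt.differentiableWithinAt ?_
    have h1 : DifferentiableAt ℂ (fun s : ℂ => hankelFactor z (n - m + s)) s := by
      refine DifferentiableAt.comp s (g := hankelFactor z) ?_ (by fun_prop)
      have := differentiableAt_hankelFactor_int_add z (n - m) (hball s hs)
      push_cast at this
      exact this
    have h2 := differentiable_rGamma
    unfold frobeniusTerm
    fun_prop
  · intro n w hw
    refine (norm_add_le _ _).trans ?_
    simp only [norm_one]
    linarith [hball w hw, (Nat.cast_nonneg m : (0 : ℝ) ≤ m)]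
  · intro n w hw
    refine (norm_add_le _ _).trans ?_
    have h1 : ‖w - 2 * m‖ ≤ ‖w‖ + 2 * m := by
      refine (norm_sub_le _ _).trans ?_
      simp
    simp only [norm_one]
    linarith [hball w hw]
  · intro n w hw
    have h1 : ‖(n : ℂ) - m + w + 1 / 2‖ ≤ n + m + ‖w‖ + 1 / 2 := by
      refine (norm_add_le _ _).trans ?_
      gcongr
      · refine (norm_add_le _ _).trans ?_
        gcongr
        refine (norm_sub_le _ _).trans ?_
        simp
      · norm_num
    simp only [norm_mul, norm_neg, Complex.norm_I, one_mul, Complex.norm_ofNat]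
    gcongr
    linarith [hball w hw, (Nat.cast_nonneg m : (0 : ℝ) ≤ m)]
  · intro n _ w hw
    have h := add_half_ne_of_norm_lt (hball w hw) (n - m) 0
    push_cast at h
    unfold frobeniusTerm
    push_cast
    rw [show (n : ℂ) + 1 - m + w = n - m + w + 1 by ring, hankelFactor_add_one hz h,
      rGamma_eq_mul ((n : ℂ) + w + 1), rGamma_eq_mul ((n : ℂ) + w - 2 * m + 1),
      show (n : ℂ) + 1 + w + 1 = n + w + 1 + 1 by ring,
      show (n : ℂ) + 1 + w - 2 * m + 1 = n + w - 2 * m + 1 + 1 by ring]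
    ring

/-- The coefficients satisfy (n+1)(n+μ+1) F_{n+1} = -(z/2)² F_n with entire terms 1/Γ, so no order
has to be avoided. -/
theorem differentiableAt_besselJ_order {z : ℂ} (hz : z ≠ 0) (μ : ℂ) :
    DifferentiableAt ℂ (fun μ => besselJ μ z) μ := by
  have hz2 : z / 2 ≠ 0 := div_ne_zero hz two_ne_zero
  have key := hasSum_deriv_of_recurrence
    (F := fun k μ => (-1) ^ k * (z / 2) ^ (2 * k) * rGamma (k + 1) * rGamma (μ + k + 1))
    (a := fun _ _ => 1)
    (b := fun _ w => w + 1) (g := fun n w => -(z / 2) ^ 2)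
    (c := μ) (R := 1) (M := ‖μ‖ + 2) (W := ‖z / 2‖ ^ 2)
    (by norm_num) ?_ 0 (by positivity) ?_ ?_ ?_ ?_
  · have h2 := key.2.1
    unfold besselJ
    refine DifferentiableAt.mul ?_ ?_
    · exact DifferentiableAt.const_cpow differentiableAt_id (Or.inl hz2)
    · refine h2.congr_of_eventuallyEq (Eventually.of_forall fun w => ?_)
      refine tsum_congr fun k => ?_
      rw [rGamma_nat_add_one, rGamma, div_eq_mul_inv, mul_inv]
      ring
  · intro n
    have h2 := differentiable_rGamma
    fun_prop
  · intro n w _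
    simp only [norm_one]
    linarith [norm_nonneg μ]
  · intro n w hw
    have h1 : ‖w - μ‖ < 1 := by simpa [dist_eq_norm] using hw
    have h2 : ‖w‖ ≤ ‖w - μ‖ + ‖μ‖ := by simpa using norm_add_le (w - μ) μ
    refine (norm_add_le _ _).trans ?_
    simp only [norm_one]
    linarith
  · intro n w _
    rw [norm_neg, norm_pow]
    exact le_mul_of_one_le_right (by positivity)
      (by linarith [norm_nonneg μ, (Nat.cast_nonneg n : (0 : ℝ) ≤ n)])
  · intro n _ w _
    push_cast
    rw [rGamma_eq_mul ((n : ℂ) + 1), rGamma_eq_mul (w + n + 1),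
      show w + (n + 1 : ℂ) + 1 = w + n + 1 + 1 by ring]
    ring

/-! ### Kummer's second transformation -/

open PowerSeries in
/-- The coefficients of `e^{iz}` times a confluent hypergeometric series of parameters `ν/2, ν`
satisfy the recurrence of the Bessel series. -/
theorem coeff_exp_mul_rec {ν : ℂ} {E M : ℂ⟦X⟧}
    (hE : ∀ n : ℕ, ((n : ℂ) + 1) * coeff (n + 1) E = Complex.I * coeff n E)
    (hM : ∀ n : ℕ, ((n : ℂ) + 1) * (n + ν) * coeff (n + 1) M =
      -Complex.I * (2 * n + ν) * coeff n M) :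
    ν * coeff 1 (E * M) = 0 ∧
      ∀ n : ℕ, ((n : ℂ) + 2) * (n + 1 + ν) * coeff (n + 2) (E * M) = -coeff n (E * M) := by
  have hE' : d⁄dX ℂ E = C Complex.I * E := by
    ext n
    rw [coeff_derivative, coeff_C_mul, ← hE, mul_comm]
  -- Kummer's equation with parameters ν/2, ν in the variable -2iz.
  have hM' : X * d⁄dX ℂ (d⁄dX ℂ M) + (C ν + C (2 * Complex.I) * X) * d⁄dX ℂ M
      + C (Complex.I * ν) * M = 0 := by
    ext n
    rw [add_mul, mul_assoc (C _) X]
    simp only [map_add, coeff_C_mul, map_zero]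
    cases n with
    | zero =>
      have := hM 0
      simp only [coeff_zero_X_mul, coeff_derivative]
      push_cast at this ⊢
      linear_combination this
    | succ n =>
      have := hM (n + 1)
      simp only [coeff_succ_X_mul, coeff_derivative]
      push_cast at this ⊢
      linear_combination this
  have hI : (C Complex.I : ℂ⟦X⟧) * C Complex.I = -1 := by
    rw [← map_mul, Complex.I_mul_I, map_neg, map_one]
  have h2I : (C (2 * Complex.I) : ℂ⟦X⟧) = 2 * C Complex.I := by
    rw [two_mul, map_add, two_mul]
  -- Multiplication by e^{iz} removes the terms with coefficient i. With ν = 2μ + 1 this is the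
  -- equation of z^{-μ} J_μ(z).
  have hf : X * d⁄dX ℂ (d⁄dX ℂ (E * M)) + C ν * d⁄dX ℂ (E * M) + X * (E * M) = 0 := by
    have hC : ∀ a : ℂ, d⁄dX ℂ (C a : ℂ⟦X⟧) = 0 := fun a => by
      ext n; simp
    simp only [Derivation.leibniz, smul_eq_mul, hE', map_add, hC]
    rw [h2I, map_mul] at hM'
    linear_combination E * hM' + (X * E * M) * hI
  constructor
  · have := congrArg (coeff 0) hf
    simp only [map_add, coeff_C_mul, map_zero, coeff_zero_X_mul, coeff_derivative] at this
    push_cast at this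
    linear_combination this
  · intro n
    have := congrArg (coeff (n + 1)) hf
    simp only [map_add, coeff_C_mul, map_zero, coeff_succ_X_mul, coeff_derivative] at this
    push_cast at this
    linear_combination this

/-- The normalised Kummer coefficients `(-2i)^n Γ(n + μ + 1/2) / (Γ(n + 2μ + 1) n!)`. -/
def kummerCoeff (μ : ℂ) (n : ℕ) : ℂ :=
  (-2 * Complex.I) ^ n * Complex.Gamma (n + μ + 1 / 2) * rGamma (n + 2 * μ + 1) * rGamma (n + 1)

theorem kummerCoeff_rec {μ : ℂ} (n : ℕ) (hμ : (n : ℂ) + μ + 1 / 2 ≠ 0) :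
    ((n : ℂ) + 1) * (n + (2 * μ + 1)) * kummerCoeff μ (n + 1) =
      -2 * Complex.I * (n + μ + 1 / 2) * kummerCoeff μ n := by
  unfold kummerCoeff
  push_cast
  rw [show (n : ℂ) + 1 + μ + 1 / 2 = n + μ + 1 / 2 + 1 by ring, Complex.Gamma_add_one _ hμ,
    rGamma_eq_mul ((n : ℂ) + 1), rGamma_eq_mul ((n : ℂ) + 2 * μ + 1),
    show (n : ℂ) + 1 + 2 * μ + 1 = n + 2 * μ + 1 + 1 by ring]
  ring

/-- Legendre's duplication formula at μ + 1/2. It fixes the constant of proportionality between the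
two series. -/
theorem kummerCoeff_zero {μ : ℂ} (hμ : ∀ n : ℕ, 2 * μ + n + 1 ≠ 0) :
    kummerCoeff μ 0 * 4 ^ μ = (Real.sqrt Real.pi : ℂ) * rGamma (μ + 1) := by
  have h := Complex.Gamma_mul_Gamma_add_half (μ + 1 / 2)
  have h1 : Complex.Gamma (2 * μ + 1) ≠ 0 := by
    refine Complex.Gamma_ne_zero fun m hm => hμ m ?_
    linear_combination hm
  have h2 : Complex.Gamma (μ + 1) ≠ 0 := by
    refine Complex.Gamma_ne_zero fun m hm => hμ (2 * m + 1) ?_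
    push_cast
    linear_combination 2 * hm
  rw [show μ + 1 / 2 + 1 / 2 = μ + 1 by ring, show 2 * (μ + 1 / 2) = 2 * μ + 1 by ring,
    show 1 - (2 * μ + 1) = -(2 * μ) by ring, Complex.cpow_neg] at h
  have h4 : (4 : ℂ) ^ μ = 2 ^ (2 * μ) := by
    rw [Complex.cpow_ofNat_mul]
    have := Complex.natCast_mul_natCast_cpow 2 2 μ
    push_cast at this
    rw [pow_two, ← this]
    norm_num
  have h5 : (2 : ℂ) ^ (2 * μ) ≠ 0 := by simp [Complex.cpow_eq_zero_iff]
  unfold kummerCoeff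
  rw [h4]
  simp only [Nat.cast_zero, zero_add, pow_zero, one_mul]
  have h6 : rGamma 1 = 1 := by simp [rGamma]
  rw [h6, rGamma, rGamma]
  generalize Complex.Gamma (2 * μ + 1) = A, Complex.Gamma (μ + 1 / 2) = B,
    Complex.Gamma (μ + 1) = D, (2 : ℂ) ^ (2 * μ) = P at *
  field_simp at h ⊢
  linear_combination h

/-- Solution of the two-step recurrence satisfied by the coefficients of the Bessel series. -/
theorem bessel_recurrence_solution {μ : ℂ} (hμ : ∀ n : ℕ, 2 * μ + n + 1 ≠ 0) {a : ℕ → ℂ}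
    (h1 : (2 * μ + 1) * a 1 = 0)
    (h2 : ∀ n : ℕ, ((n : ℂ) + 2) * (n + 1 + (2 * μ + 1)) * a (n + 2) = -a n) :
    (∀ k : ℕ, a (2 * k + 1) = 0) ∧ ∀ k : ℕ, a (2 * k) = a 0 * Complex.Gamma (μ + 1) *
      ((-1) ^ k * (1 / 2) ^ (2 * k) / ((k.factorial : ℂ) * Complex.Gamma (μ + k + 1))) := by
  have hΓ : ∀ k : ℕ, Complex.Gamma (μ + k + 1) ≠ 0 := fun k =>
    Complex.Gamma_ne_zero fun m hm => hμ (2 * (k + m) + 1) (by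
      push_cast
      linear_combination 2 * hm)
  have hodd : ∀ k : ℕ, a (2 * k + 1) = 0 := by
    intro k
    induction k with
    | zero =>
      have : 2 * μ + 1 ≠ 0 := by simpa using hμ 0
      simpa [this] using h1
    | succ k ih =>
      have h := h2 (2 * k + 1)
      rw [ih, neg_zero] at h
      have e1 : ((2 * k + 1 : ℕ) : ℂ) + 2 ≠ 0 := by exact_mod_cast (2 * k + 2).succ_ne_zero
      have e2 : ((2 * k + 1 : ℕ) : ℂ) + 1 + (2 * μ + 1) ≠ 0 := by
        have := hμ (2 * k + 2)
        push_cast at this ⊢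
        intro h0
        exact this (by linear_combination h0)
      exact (mul_eq_zero.mp h).resolve_left (mul_ne_zero e1 e2)
  refine ⟨hodd, fun k => ?_⟩
  · clear hodd
    induction k with
    | zero =>
      have := hΓ 0
      simp only [Nat.cast_zero, add_zero] at this
      simp only [mul_zero, pow_zero, Nat.factorial_zero, Nat.cast_one, Nat.cast_zero, add_zero]
      field_simp
    | succ k ih =>
      have h := h2 (2 * k)
      have e2 : μ + k + 1 ≠ 0 := by
        have := hμ (2 * k + 1)
        push_cast at this
        intro h0
        exact this (by linear_combination 2 * h0)
      have e3 : (k : ℂ) + 1 ≠ 0 := by exact_mod_cast k.succ_ne_zero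
      have e4 : (k.factorial : ℂ) ≠ 0 := by exact_mod_cast k.factorial_ne_zero
      have e5 := hΓ k
      rw [ih] at h
      rw [show 2 * (k + 1) = 2 * k + 2 by ring, Nat.factorial_succ, Nat.cast_succ,
        show μ + ((k : ℂ) + 1) + 1 = μ + k + 1 + 1 by ring, Complex.Gamma_add_one _ e2]
      have e6 : (((2 * k : ℕ) : ℂ) + 2) * ((2 * k : ℕ) + 1 + (2 * μ + 1)) ≠ 0 := by
        push_cast
        rw [show (2 * (k : ℂ) + 2) * (2 * k + 1 + (2 * μ + 1)) = 4 * ((k + 1) * (μ + k + 1)) by ring]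
        exact mul_ne_zero (by norm_num) (mul_ne_zero e3 e2)
      refine mul_left_cancel₀ e6 (h.trans ?_)
      push_cast
      rw [pow_succ, pow_add]
      field_simp
      ring

-- The Cauchy product of the two series obeys the Bessel recurrence, which kills the odd
-- coefficients and determines the even ones from the constant term. Excluding negative integers for
-- 2μ keeps every step of the recurrence solvable.
open PowerSeries in
theorem exp_mul_tsum_kummerCoeff {μ : ℂ} (hμ : ∀ n : ℕ, 2 * μ + n + 1 ≠ 0) {z : ℂ}
    (hs : Summable fun n => ‖kummerCoeff μ n * z ^ n‖) :
    Complex.exp (Complex.I * z) * ∑' n, kummerCoeff μ n * z ^ n =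
      kummerCoeff μ 0 * Complex.Gamma (μ + 1) *
        ∑' k : ℕ, (-1) ^ k * (z / 2) ^ (2 * k) / ((k.factorial : ℂ) * Complex.Gamma (μ + k + 1)) := by
  obtain ⟨E, hEdef⟩ : ∃ E : ℂ⟦X⟧, ∀ n, coeff n E = Complex.I ^ n / (n.factorial : ℂ) :=
    ⟨mk fun n => Complex.I ^ n / (n.factorial : ℂ), fun n => coeff_mk _ _⟩
  obtain ⟨M, hMdef⟩ : ∃ M : ℂ⟦X⟧, ∀ n, coeff n M = kummerCoeff μ n :=
    ⟨mk (kummerCoeff μ), fun n => coeff_mk _ _⟩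
  obtain ⟨h1, h2⟩ := coeff_exp_mul_rec (ν := 2 * μ + 1) (E := E) (M := M)
    (fun n => by
      simp only [hEdef, Nat.factorial_succ, pow_succ]
      have : (n.factorial : ℂ) ≠ 0 := by exact_mod_cast n.factorial_ne_zero
      have : (n : ℂ) + 1 ≠ 0 := by exact_mod_cast n.succ_ne_zero
      push_cast
      field_simp)
    (fun n => by
      simp only [hMdef]
      rw [kummerCoeff_rec n fun h => hμ (2 * n) (by
        push_cast
        linear_combination 2 * h)]
      ring)
  have h0 : coeff 0 (E * M) = kummerCoeff μ 0 := by
    simp [coeff_mul, hEdef, hMdef]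
  obtain ⟨hodd, heven⟩ := bessel_recurrence_solution hμ (a := fun n => coeff n (E * M)) h1 h2
  simp only [h0] at heven hodd
  have hEs : Summable fun n => ‖coeff n E * z ^ n‖ := by
    have := NormedSpace.norm_expSeries_div_summable (Complex.I * z)
    simpa [hEdef, mul_pow, div_mul_eq_mul_div] using this
  have hexp : Complex.exp (Complex.I * z) = ∑' n, coeff n E * z ^ n := by
    rw [Complex.exp_eq_exp_ℂ, NormedSpace.exp_eq_tsum_div]
    simp [hEdef, mul_pow, div_mul_eq_mul_div]
  have hMs : Summable fun n => ‖coeff n M * z ^ n‖ := by simpa [hMdef] using hs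
  have hprod : ∀ n, ∑ kl ∈ Finset.HasAntidiagonal.antidiagonal n,
      coeff kl.1 E * z ^ kl.1 * (coeff kl.2 M * z ^ kl.2) = coeff n (E * M) * z ^ n := by
    intro n
    rw [coeff_mul, Finset.sum_mul]
    refine Finset.sum_congr rfl fun kl hkl => ?_
    rw [← Finset.HasAntidiagonal.mem_antidiagonal.mp hkl, pow_add]
    ring
  have hsum : Summable fun n => coeff n (E * M) * z ^ n := by
    have := (summable_norm_sum_mul_antidiagonal_of_summable_norm hEs hMs).of_norm
    simpa only [hprod] using this
  have hfin : Complex.exp (Complex.I * z) * ∑' n, kummerCoeff μ n * z ^ n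
      = ∑' n, coeff n (E * M) * z ^ n := by
    rw [hexp, show (∑' n, kummerCoeff μ n * z ^ n) = ∑' n, coeff n M * z ^ n by simp [hMdef],
      tsum_mul_tsum_eq_tsum_sum_antidiagonal_of_summable_norm hEs hMs]
    exact tsum_congr hprod
  have he : Summable fun k : ℕ => coeff (2 * k) (E * M) * z ^ (2 * k) :=
    hsum.comp_injective (fun a b h => by simpa using h : Function.Injective fun k : ℕ => 2 * k)
  have ho : Summable fun k : ℕ => coeff (2 * k + 1) (E * M) * z ^ (2 * k + 1) :=
    hsum.comp_injective
      (fun a b h => by simpa using h : Function.Injective fun k : ℕ => 2 * k + 1)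
  have ho' : ∑' k : ℕ, coeff (2 * k + 1) (E * M) * z ^ (2 * k + 1) = 0 := by
    simp [hodd]
  have hsplit := tsum_even_add_odd (f := fun n => coeff n (E * M) * z ^ n) he ho
  rw [ho', add_zero] at hsplit
  rw [hfin, ← hsplit, ← tsum_mul_left]
  refine tsum_congr fun k => ?_
  rw [heven, div_pow, div_pow]
  ring

theorem kummerTerm_eq_mul_kummerCoeff {z : ℂ} (hz : z ≠ 0) (n : ℕ) (μ : ℂ) :
    kummerTerm z n μ =
      Complex.exp (μ * (logNegI z + Real.log 2)) / (Real.sqrt Real.pi : ℂ) *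
        (kummerCoeff μ n * z ^ n) := by
  unfold kummerTerm hankelFactor kummerCoeff
  rw [add_mul, Complex.exp_add, Complex.exp_nat_mul, exp_two_log_add hz,
    show -Complex.I * z * 2 = -2 * Complex.I * z by ring, mul_pow]
  ring

/-- Kummer's second transformation, away from the half-integers. -/
theorem exp_mul_kummerSum_of_ne {z μ : ℂ} (hz : z ≠ 0) (hμ : ∀ n : ℤ, 2 * μ ≠ n)
    (hs : Summable fun n => ‖kummerTerm z n μ‖) :
    Complex.exp (Complex.I * z) * kummerSum z μ =
      Complex.exp (-(Complex.I * (Real.pi / 2)) * μ) * besselJ μ z := by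
  have hμ' : ∀ n : ℕ, 2 * μ + n + 1 ≠ 0 := fun n h => hμ (-(n + 1)) (by
    push_cast
    linear_combination h)
  have hπ : (Real.sqrt Real.pi : ℂ) ≠ 0 := by
    exact_mod_cast (Real.sqrt_pos.mpr Real.pi_pos).ne'
  have hΓ : Complex.Gamma (μ + 1) ≠ 0 := by
    refine Complex.Gamma_ne_zero fun m hm => hμ' (2 * m + 1) ?_
    push_cast
    linear_combination 2 * hm
  set c := Complex.exp (μ * (logNegI z + Real.log 2)) / (Real.sqrt Real.pi : ℂ) with hc
  have hc0 : c ≠ 0 := div_ne_zero (Complex.exp_ne_zero _) hπ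
  have hs' : Summable fun n => ‖kummerCoeff μ n * z ^ n‖ := by
    simp only [kummerTerm_eq_mul_kummerCoeff hz, ← hc] at hs
    simp only [norm_mul c] at hs
    exact (summable_mul_left_iff (norm_ne_zero_iff.mpr hc0)).mp hs
  have h := exp_mul_tsum_kummerCoeff hμ' hs'
  have h4 : (4 : ℂ) ^ μ ≠ 0 := by simp [Complex.cpow_eq_zero_iff]
  have h0 := kummerCoeff_zero hμ'
  have h0' : kummerCoeff μ 0 * Complex.Gamma (μ + 1) = (Real.sqrt Real.pi : ℂ) / 4 ^ μ := by
    rw [eq_div_iff h4, mul_right_comm, h0, rGamma]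
    field_simp
  -- The power (-2iz)^μ is taken with logarithm log z - iπ/2 + log 2; dividing by 4^μ leaves
  -- e^{-iπμ/2} (z/2)^μ exactly, for every argument of z.
  have hcz : c * ((Real.sqrt Real.pi : ℂ) / 4 ^ μ) =
      Complex.exp (-(Complex.I * (Real.pi / 2)) * μ) * (z / 2) ^ μ := by
    have hlog : Complex.log (z / 2) = Complex.log z - Real.log 2 := by
      have h := Complex.log_ofReal_mul (r := 1 / 2) (by norm_num) hz
      rw [Real.log_div one_ne_zero two_ne_zero, Real.log_one, zero_sub] at h
      push_cast at h
      rw [show z / 2 = 1 / 2 * z by ring, h]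
      ring
    have hlog4 : Complex.log 4 = 2 * Real.log 2 := by
      rw [show (4 : ℂ) = ((2 ^ 2 : ℝ) : ℂ) by norm_num, ← Complex.ofReal_log (by norm_num),
        Real.log_pow]
      push_cast
      ring
    rw [hc, div_mul_div_comm, mul_comm (Complex.exp _), mul_div_mul_left _ _ hπ,
      Complex.cpow_def_of_ne_zero (div_ne_zero hz two_ne_zero),
      Complex.cpow_def_of_ne_zero (by norm_num : (4 : ℂ) ≠ 0), ← Complex.exp_sub, ← Complex.exp_add, hlog, hlog4,
      logNegI]
    congr 1
    ring
  unfold kummerSum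
  simp only [kummerTerm_eq_mul_kummerCoeff hz]
  rw [tsum_mul_left, mul_left_comm, h, h0', ← mul_assoc, hcz, besselJ, mul_assoc]

theorem eventually_two_mul_ne_int (p : ℤ) :
    ∀ᶠ μ : ℂ in 𝓝[≠] (p : ℂ), ∀ n : ℤ, 2 * μ ≠ n := by
  have hb : ∀ᶠ μ : ℂ in 𝓝[≠] (p : ℂ), μ ∈ Metric.ball (p : ℂ) (1 / 4) :=
    eventually_nhdsWithin_of_eventually_nhds (Metric.ball_mem_nhds _ (by norm_num))
  filter_upwards [hb, self_mem_nhdsWithin] with μ hμ hne n h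
  rw [Metric.mem_ball, dist_eq_norm] at hμ
  have h1 : μ - p = (((n - 2 * p : ℤ) : ℝ) / 2 : ℝ) := by
    push_cast
    linear_combination h / 2
  rw [h1, Complex.norm_real, Real.norm_eq_abs, abs_lt] at hμ
  have h2 : (-1 : ℝ) < ((n - 2 * p : ℤ) : ℝ) := by linarith
  have h3 : ((n - 2 * p : ℤ) : ℝ) < 1 := by linarith
  have h4 : -1 < n - 2 * p := by exact_mod_cast h2
  have h5 : n - 2 * p < 1 := by exact_mod_cast h3
  have h6 : n = 2 * p := by omega
  refine hne ?_
  rw [h6] at h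
  push_cast at h
  simpa using h

/-- Both sides are continuous at an integer order, so the identity off the half-integer lattice
extends across it. Equality on a full neighbourhood is what allows differentiation in the order. -/
theorem exp_mul_kummerSum_eventuallyEq {z : ℂ} (hz : z ≠ 0) (p : ℤ) :
    (fun μ => Complex.exp (Complex.I * z) * kummerSum z μ) =ᶠ[𝓝 (p : ℂ)]
      fun μ => Complex.exp (-(Complex.I * (Real.pi / 2)) * μ) * besselJ μ z := by
  have h := hasSum_deriv_kummerTerm hz p
  have h1 := h.2.1
  have h2 := differentiableAt_besselJ_order hz p
  refine (ContinuousAt.eventuallyEq_nhds_iff_eventuallyEq_nhdsNE ?_ ?_).mp ?_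
  · exact (h1.const_mul _).continuousAt
  · exact DifferentiableAt.continuousAt (𝕜 := ℂ) (by fun_prop)
  · have hb : ∀ᶠ μ : ℂ in 𝓝[≠] (p : ℂ), μ ∈ Metric.ball (p : ℂ) (1 / 4 / 2) :=
      eventually_nhdsWithin_of_eventually_nhds (Metric.ball_mem_nhds _ (by norm_num))
    filter_upwards [hb, eventually_two_mul_ne_int p] with μ hμ hne
    exact exp_mul_kummerSum_of_ne hz hne (h.1 μ hμ)

theorem exp_mul_kummerSum {z : ℂ} (hz : z ≠ 0) (p : ℤ) :
    Complex.exp (Complex.I * z) * kummerSum z p =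
      Complex.exp (-(Complex.I * (Real.pi / 2)) * p) * besselJ p z :=
  (exp_mul_kummerSum_eventuallyEq hz p).self_of_nhds

theorem exp_mul_deriv_kummerSum {z : ℂ} (hz : z ≠ 0) (p : ℤ) :
    Complex.exp (Complex.I * z) * deriv (kummerSum z) p =
      Complex.exp (-(Complex.I * (Real.pi / 2)) * p) *
        (deriv (fun μ => besselJ μ z) p - Complex.I * (Real.pi / 2) * besselJ p z) := by
  have h1 := (hasSum_deriv_kummerTerm hz p).2.1.hasDerivAt.const_mul (Complex.exp (Complex.I * z))
  have h2 := (differentiableAt_besselJ_order hz p).hasDerivAt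
  have h3 := (((hasDerivAt_id (p : ℂ)).const_mul (-(Complex.I * (Real.pi / 2)))).cexp).mul h2
  have h4 := (h3.congr_of_eventuallyEq (exp_mul_kummerSum_eventuallyEq hz p)).unique h1
  rw [← h4]
  simp only [id]
  ring

/-! ### Integer orders: reflection and the limit defining Y -/

theorem exp_neg_I_pi_div_two_mul_int (p : ℤ) :
    Complex.exp (-(Complex.I * (Real.pi / 2)) * p) = (-Complex.I) ^ p := by
  rw [mul_comm, Complex.exp_int_mul,
    show -(Complex.I * (Real.pi / 2)) = -Real.pi / 2 * Complex.I by ring,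
    Complex.exp_neg_pi_div_two_mul_I]

theorem rGamma_sub_eq_zero {n k : ℕ} (h : n < k) : rGamma (n - k + 1) = 0 := by
  obtain ⟨j, rfl⟩ := Nat.exists_eq_add_of_lt h
  have := rGamma_neg_nat j
  push_cast
  rwa [show (n : ℂ) - (n + j + 1) + 1 = -j by ring]

theorem kummerTerm_neg_of_lt (z : ℂ) {m n : ℕ} (h : n < 2 * m) : kummerTerm z n (-m) = 0 := by
  have := rGamma_sub_eq_zero h
  push_cast at this
  rw [kummerTerm, show (n : ℂ) + 2 * -m + 1 = n - 2 * m + 1 by ring, this, mul_zero]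

theorem kummerTerm_neg_add (z : ℂ) (m n : ℕ) :
    kummerTerm z (n + 2 * m) (-m) = kummerTerm z n m := by
  unfold kummerTerm
  push_cast
  rw [show (n : ℂ) + 2 * m + -m = n + m by ring, show (n : ℂ) + 2 * m + 2 * -m + 1 = n + 1 by ring]
  ring

/-- At order -m the first 2m terms are killed by zeros of 1/Γ, and shifting the index by 2m turns
the rest into the series at order m. This is the source of J_{-m} = (-1)^m J_m. -/
theorem kummerSum_neg {z : ℂ} (hz : z ≠ 0) (m : ℕ) : kummerSum z (-m) = kummerSum z m := by
  have hs : Summable fun n => kummerTerm z n (-m) := by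
    have h := (hasSum_deriv_kummerTerm hz (-m)).1
    push_cast at h
    exact (h _ (Metric.mem_ball_self (by norm_num))).of_norm
  unfold kummerSum
  rw [← hs.sum_add_tsum_nat_add (2 * m),
    Finset.sum_eq_zero fun n hn => kummerTerm_neg_of_lt z (Finset.mem_range.mp hn), zero_add]
  exact tsum_congr fun n => kummerTerm_neg_add z m n

theorem besselJ_neg_nat {z : ℂ} (hz : z ≠ 0) (m : ℕ) :
    besselJ (-m) z = (-1) ^ m * besselJ m z := by
  have h1 := exp_mul_kummerSum hz m
  have h2 := exp_mul_kummerSum hz (-m)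
  rw [exp_neg_I_pi_div_two_mul_int] at h1 h2
  push_cast at h1 h2
  rw [kummerSum_neg hz, h1, zpow_neg, ← inv_zpow, zpow_natCast, zpow_natCast, inv_neg,
    Complex.inv_I, neg_neg] at h2
  have h3 : Complex.I ^ m * (-Complex.I) ^ m = 1 := by
    rw [← mul_pow]; simp
  have h4 : (-Complex.I) ^ m * (-Complex.I) ^ m = (-1) ^ m := by
    rw [← mul_pow]; simp
  linear_combination (-besselJ (-m) z) * h3 + (besselJ m z) * h4 - (-Complex.I) ^ m * h2

theorem besselJ_neg_int {z : ℂ} (hz : z ≠ 0) (p : ℤ) :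
    besselJ (-p) z = (-1) ^ p * besselJ p z := by
  obtain ⟨m, rfl | rfl⟩ := p.eq_nat_or_neg
  · simpa using besselJ_neg_nat hz m
  · have h := besselJ_neg_nat hz m
    push_cast
    rw [h, neg_neg, zpow_neg, ← inv_zpow, zpow_natCast, ← mul_assoc, ← mul_pow]
    norm_num

/-- L'Hôpital: by reflection the numerator vanishes at `p`, as does the sine, so the quotient is a
ratio of slopes, the lower one tending to (-1)^p π. -/
theorem tendsto_besselYQuotient {z : ℂ} (hz : z ≠ 0) (p : ℤ) :
    Tendsto (fun ν => besselYQuotient ν z) (𝓝[≠] (p : ℂ))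
      (𝓝 ((deriv (fun μ => besselJ μ z) p + (-1) ^ p * deriv (fun μ => besselJ μ z) (-p)) /
        Real.pi)) := by
  have hπ : (Real.pi : ℂ) ≠ 0 := by exact_mod_cast Real.pi_ne_zero
  have hcos : Complex.cos (p * Real.pi) = (-1) ^ p := by
    rw [← Complex.ofReal_intCast, ← Complex.ofReal_mul, ← Complex.ofReal_cos, Real.cos_int_mul_pi]
    push_cast
    rfl
  have hsin : Complex.sin (p * Real.pi) = 0 := Complex.sin_int_mul_pi p
  have hJ := (differentiableAt_besselJ_order hz p).hasDerivAt
  have hJ' : HasDerivAt (fun μ => besselJ (-μ) z) (-deriv (fun μ => besselJ μ z) (-p)) (p : ℂ) := by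
    have := (differentiableAt_besselJ_order hz (-p)).hasDerivAt.scomp (p : ℂ) (hasDerivAt_neg (p : ℂ))
    simpa [Function.comp_def] using this
  have hid := (hasDerivAt_id (p : ℂ)).mul_const (Real.pi : ℂ)
  have hN := (hJ.mul hid.ccos).sub hJ'
  have hS := hid.csin
  simp only [id, hcos, hsin] at hN hS
  have hN0 : besselJ p z * Complex.cos (p * Real.pi) - besselJ (-p) z = 0 := by
    rw [hcos, besselJ_neg_int hz]
    ring
  have hsq : ((-1 : ℂ) ^ p) * (-1) ^ p = 1 := by
    rw [← mul_zpow]; norm_num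
  have h := hN.tendsto_slope.div hS.tendsto_slope (by
    have : ((-1 : ℂ) ^ p) ≠ 0 := zpow_ne_zero _ (by norm_num)
    simp [this, hπ])
  have hlim : (deriv (fun μ => besselJ μ z) p * (-1) ^ p + besselJ p z * (-0 * (1 * Real.pi)) -
      -deriv (fun μ => besselJ μ z) (-p)) / ((-1) ^ p * (1 * Real.pi)) =
      (deriv (fun μ => besselJ μ z) p + (-1) ^ p * deriv (fun μ => besselJ μ z) (-p)) /
        Real.pi := by
    have : ((-1 : ℂ) ^ p) ≠ 0 := zpow_ne_zero _ (by norm_num)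
    field_simp
    linear_combination (-deriv (fun μ => besselJ μ z) (-p)) * hsq
  rw [hlim] at h
  refine h.congr' ?_
  filter_upwards [self_mem_nhdsWithin] with ν hν
  have hν' : ν - p ≠ 0 := sub_ne_zero.mpr hν
  simp only [slope, vsub_eq_sub, smul_eq_mul, Pi.div_apply, Pi.sub_apply, Pi.mul_apply, id] at *
  rw [hN0, hsin, sub_zero, sub_zero, mul_div_mul_left _ _ (inv_ne_zero hν'), besselYQuotient]

theorem besselY_int {z : ℂ} (hz : z ≠ 0) (p : ℤ) :
    besselY p z = (deriv (fun μ => besselJ μ z) p +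
      (-1) ^ p * deriv (fun μ => besselJ μ z) (-p)) / Real.pi := by
  rw [besselY, if_pos ⟨p, rfl⟩]
  exact (tendsto_besselYQuotient hz p).limUnder_eq

theorem tendsto_besselY {z : ℂ} (hz : z ≠ 0) (p : ℤ) :
    Tendsto (fun μ => besselY μ z) (𝓝[≠] (p : ℂ)) (𝓝 (besselY p z)) := by
  rw [besselY_int hz]
  refine (tendsto_besselYQuotient hz p).congr' ?_
  filter_upwards [eventually_two_mul_ne_int p] with μ hμ
  rw [besselY, if_neg]
  rintro ⟨n, rfl⟩
  exact hμ (2 * n) (by push_cast; ring)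

theorem besselY_neg_int {z : ℂ} (hz : z ≠ 0) (p : ℤ) :
    besselY (-p : ℤ) z = (-1) ^ p * besselY p z := by
  rw [besselY_int hz, besselY_int hz]
  have hsq : ((-1 : ℂ) ^ p) * (-1) ^ p = 1 := by
    rw [← mul_zpow]; norm_num
  have hinv : ((-1 : ℂ) ^ (-p)) = (-1) ^ p := by
    rw [zpow_neg, ← inv_zpow]; norm_num
  push_cast
  rw [neg_neg, hinv]
  linear_combination (-deriv (fun μ => besselJ μ z) (-p) / Real.pi) * hsq

/-! ### Order derivatives as one exponent derivative -/

theorem hasDerivAt_hankelFactor_int (z : ℂ) (p : ℤ) :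
    HasDerivAt (hankelFactor z) (deriv (hankelFactor z) p) p := by
  have := differentiableAt_hankelFactor_int_add z p (s := 0) (by norm_num)
  rw [add_zero] at this
  exact this.hasDerivAt

theorem deriv_kummerTerm_int (z : ℂ) (n : ℕ) (p : ℤ) :
    deriv (kummerTerm z n) p =
      deriv (hankelFactor z) (n + p) * rGamma (n + 1) * rGamma (n + 2 * p + 1) +
        2 * hankelFactor z (n + p) * rGamma (n + 1) * deriv rGamma (n + 2 * p + 1) := by
  have h1 : HasDerivAt (fun μ : ℂ => hankelFactor z (n + μ)) (deriv (hankelFactor z) (n + p)) p := by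
    have := hasDerivAt_hankelFactor_int z (n + p)
    push_cast at this
    exact HasDerivAt.comp_const_add (n : ℂ) (p : ℂ) this
  have h2 : HasDerivAt (fun μ : ℂ => rGamma (n + 2 * μ + 1))
      (deriv rGamma (n + 2 * p + 1) * (2 * 1)) p :=
    HasDerivAt.comp (h₂ := rGamma) (p : ℂ) (differentiable_rGamma _).hasDerivAt
      ((((hasDerivAt_id (p : ℂ)).const_mul 2).const_add (n : ℂ)).add_const 1)
  have h := (h1.mul_const (rGamma (n + 1))).mul h2
  refine HasDerivAt.deriv (h.congr_deriv ?_)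
  ring

theorem deriv_frobeniusTerm_zero (z : ℂ) (m n : ℕ) :
    deriv (frobeniusTerm z m n) 0 =
      deriv (hankelFactor z) (n - m) * rGamma (n + 1) * rGamma (n - 2 * m + 1) +
        hankelFactor z (n - m) * (deriv rGamma (n + 1) * rGamma (n - 2 * m + 1) +
          rGamma (n + 1) * deriv rGamma (n - 2 * m + 1)) := by
  have h1 : HasDerivAt (fun s : ℂ => hankelFactor z (n - m + s))
      (deriv (hankelFactor z) (n - m)) 0 := by
    have := hasDerivAt_hankelFactor_int z (n - m)
    push_cast at this
    exact HasDerivAt.comp_const_add ((n : ℂ) - m) 0 (by rwa [add_zero])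
  have h2 : HasDerivAt (fun s : ℂ => rGamma (n + s + 1)) (deriv rGamma (n + 1)) 0 := by
    have := HasDerivAt.comp (0 : ℂ) (differentiable_rGamma (n + 0 + 1)).hasDerivAt
      (((hasDerivAt_id (0 : ℂ)).const_add (n : ℂ)).add_const 1)
    simpa [Function.comp_def] using this
  have h3 : HasDerivAt (fun s : ℂ => rGamma (n + s - 2 * m + 1))
      (deriv rGamma (n - 2 * m + 1)) 0 := by
    have := HasDerivAt.comp (0 : ℂ) (differentiable_rGamma (n + 0 - 2 * m + 1)).hasDerivAt
      ((((hasDerivAt_id (0 : ℂ)).const_add (n : ℂ)).sub_const (2 * m : ℂ)).add_const 1)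
    simpa [Function.comp_def] using this
  have h := (h1.mul h2).mul h3
  refine HasDerivAt.deriv (h.congr_deriv ?_)
  simp only [add_zero, Pi.mul_apply]
  ring

/-- The last reciprocal Gamma vanishes, so only its own derivative survives. The factor 2 arises
because the Kummer term contains it with argument 2μ rather than s. -/
theorem two_mul_deriv_frobeniusTerm_of_lt (z : ℂ) {m n : ℕ} (h : n < 2 * m) :
    2 * deriv (frobeniusTerm z m n) 0 = deriv (kummerTerm z n) (-m) := by
  have h0 := rGamma_sub_eq_zero h
  have h1 := deriv_kummerTerm_int z n (-m)
  push_cast at h0 h1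
  rw [deriv_frobeniusTerm_zero, h1, h0, show (n : ℂ) + 2 * -m + 1 = n - 2 * m + 1 by ring, h0,
    ← sub_eq_add_neg]
  ring

/-- Each Kummer term differentiates just one of its two reciprocal Gammas, with weight 2: Γ(j+2m+1)
at order m, Γ(j+1) at order -m. The Frobenius term differentiates both with weight 1, hence is their
average. -/
theorem two_mul_deriv_frobeniusTerm_add (z : ℂ) (m j : ℕ) :
    2 * deriv (frobeniusTerm z m (j + 2 * m)) 0 =
      deriv (kummerTerm z j) m + deriv (kummerTerm z (j + 2 * m)) (-m) := by
  have h1 := deriv_kummerTerm_int z (j + 2 * m) (-m)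
  have h2 := deriv_kummerTerm_int z j m
  push_cast at h1 h2
  rw [deriv_frobeniusTerm_zero, h1, h2]
  push_cast
  rw [show (j : ℂ) + 2 * m + 2 * -m + 1 = j + 1 by ring, show (j : ℂ) + 2 * m + -m = j + m by ring,
    show (j : ℂ) + 2 * m - m = j + m by ring, show (j : ℂ) + 2 * m - 2 * m + 1 = j + 1 by ring]
  ring

/-- The derivative of the Frobenius series in the exponent. -/
theorem two_mul_tsum_deriv_frobeniusTerm {z : ℂ} (hz : z ≠ 0) (m : ℕ) :
    2 * ∑' n, deriv (frobeniusTerm z m n) 0 =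
      deriv (kummerSum z) m + deriv (kummerSum z) (-m) := by
  have hF := (hasSum_deriv_frobeniusTerm hz m).2.summable
  have hP := (hasSum_deriv_kummerTerm hz m).2.2
  have hN := (hasSum_deriv_kummerTerm hz (-m)).2.2
  push_cast at hP hN
  rw [← hF.sum_add_tsum_nat_add (2 * m), ← hN.tsum_eq, ← hN.summable.sum_add_tsum_nat_add (2 * m),
    mul_add, Finset.mul_sum, ← tsum_mul_left, ← hP.tsum_eq,
    Finset.sum_congr rfl fun n hn => two_mul_deriv_frobeniusTerm_of_lt z (Finset.mem_range.mp hn)]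
  simp only [two_mul_deriv_frobeniusTerm_add]
  rw [hP.summable.tsum_add ((summable_nat_add_iff (2 * m)).mpr hN.summable)]
  ring

/-- `Y_m` in terms of the derivative of the Frobenius series. -/
theorem besselY_eq_tsum_deriv_frobeniusTerm {z : ℂ} (hz : z ≠ 0) (m : ℕ) :
    besselY m z = 2 * Complex.I ^ m / Real.pi * (Complex.exp (Complex.I * z) *
      ∑' n, deriv (frobeniusTerm z m n) 0 +
        Complex.I * (Real.pi / 2) * (Complex.exp (Complex.I * z) * kummerSum z m)) := by
  have hπ : (Real.pi : ℂ) ≠ 0 := by exact_mod_cast Real.pi_ne_zero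
  have hY := besselY_int hz m
  have h1 := exp_mul_deriv_kummerSum hz m
  have h2 := exp_mul_deriv_kummerSum hz (-m)
  have h3 := exp_mul_kummerSum hz m
  have hG := two_mul_tsum_deriv_frobeniusTerm hz m
  rw [exp_neg_I_pi_div_two_mul_int] at h1 h2 h3
  push_cast at hY h1 h2 h3
  rw [zpow_neg, ← inv_zpow, zpow_natCast, inv_neg, Complex.inv_I, neg_neg,
    besselJ_neg_nat hz] at h2
  rw [zpow_natCast] at h1 h3 hY
  have h4 : Complex.I ^ m * (-Complex.I) ^ m = 1 := by
    rw [← mul_pow]; simp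
  have h5 : Complex.I ^ m * Complex.I ^ m = (-1) ^ m := by
    rw [← mul_pow]; simp
  have h6 : ((-1 : ℂ) ^ m) * (-1) ^ m = 1 := by
    rw [← mul_pow]; simp
  rw [hY, h3]
  field_simp
  generalize deriv (fun μ => besselJ μ z) (m : ℂ) = A at *
  generalize deriv (fun μ => besselJ μ z) (-(m : ℂ)) = B at *
  generalize (∑' n, deriv (frobeniusTerm z m n) 0) = G at *
  generalize besselJ m z = J at *
  -- Each order contributes -iπ/2 times J from differentiating e^{-iπμ/2}; together they account for
  -- the iπ/2 multiple of the Kummer sum.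
  have key : Complex.I ^ m * (2 * (Complex.exp (Complex.I * z) * G)) =
      (A - Complex.I * (Real.pi / 2) * J) +
        ((-1) ^ m * B - Complex.I * (Real.pi / 2) * J) := by
    linear_combination (Complex.I ^ m * Complex.exp (Complex.I * z)) * hG +
      Complex.I ^ m * h1 + Complex.I ^ m * h2 + (A - Complex.I * (Real.pi / 2) * J) * h4 +
      (B - Complex.I * (Real.pi / 2) * ((-1) ^ m * J)) * h5 - Complex.I * (Real.pi / 2) * J * h6
  linear_combination -key - Complex.I * Real.pi * J * h4

/-! ### The exponential integral Γ(0, w) and its expansion at the origin -/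

theorem upperGamma_zero (w : ℂ) :
    upperGamma 0 w = ∫ t in Set.Ioi (0 : ℝ), (w + t)⁻¹ * Complex.exp (-(w + t)) := by
  simp [upperGamma, Complex.cpow_neg_one]

theorem ofReal_neg_notMem_slitPlane {t : ℝ} (ht : 0 ≤ t) : -(t : ℂ) ∉ Complex.slitPlane := by
  rw [Complex.mem_slitPlane_iff]
  simp [ht]

/-- If w + t were small, -t would be close to w₀, yet it lies on the cut. The bound is uniform in t,
as dominated differentiation needs. -/
theorem exists_ball_le_norm_add {w₀ : ℂ} (hw₀ : w₀ ∈ Complex.slitPlane) :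
    ∃ ε > 0, ∀ w ∈ Metric.ball w₀ ε, ∀ t : ℝ, 0 ≤ t → ε ≤ ‖w + t‖ := by
  obtain ⟨ε, hε, hsub⟩ := Metric.isOpen_iff.mp Complex.isOpen_slitPlane w₀ hw₀
  refine ⟨ε / 2, by positivity, fun w hw t ht => ?_⟩
  by_contra! hlt
  refine ofReal_neg_notMem_slitPlane ht (hsub ?_)
  rw [Metric.mem_ball, dist_eq_norm] at hw ⊢
  calc ‖-(t : ℂ) - w₀‖ = ‖(w - w₀) - (w + t)‖ := by congr 1; ring
    _ ≤ ‖w - w₀‖ + ‖w + t‖ := norm_sub_le _ _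
    _ < ε := by linarith

theorem hasDerivAt_inv_mul_exp_neg {x : ℂ} (hx : x ≠ 0) :
    HasDerivAt (fun x : ℂ => x⁻¹ * Complex.exp (-x))
      (-(x ^ 2)⁻¹ * Complex.exp (-x) + x⁻¹ * (Complex.exp (-x) * -1)) x :=
  (hasDerivAt_inv hx).mul (hasDerivAt_neg x).cexp

/-- The integrand depends on w + t only, so its derivative in w is its derivative in t, and the
differentiated integral telescopes to minus the value at t = 0. -/
theorem hasDerivAt_upperGamma_zero {w₀ : ℂ} (hw₀ : w₀ ∈ Complex.slitPlane) :
    HasDerivAt (upperGamma 0) (-(w₀⁻¹ * Complex.exp (-w₀))) w₀ := by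
  obtain ⟨ε, hε, hlow⟩ := exists_ball_le_norm_add hw₀
  set F' : ℂ → ℝ → ℂ := fun w t => -((w + t) ^ 2)⁻¹ * Complex.exp (-(w + t)) +
    (w + t)⁻¹ * (Complex.exp (-(w + t)) * -1) with hF'
  have hne : ∀ w ∈ Metric.ball w₀ ε, ∀ t : ℝ, 0 ≤ t → w + t ≠ 0 := fun w hw t ht h => by
    have := hlow w hw t ht
    rw [h, norm_zero] at this
    linarith
  have hc : w₀ ∈ Metric.ball w₀ ε := Metric.mem_ball_self hε
  have hcont : ∀ w ∈ Metric.ball w₀ ε, ContinuousOn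
      (fun t : ℝ => (w + t)⁻¹ * Complex.exp (-(w + t))) (Set.Ici 0) := fun w hw =>
    ContinuousOn.mul (ContinuousOn.inv₀ (by fun_prop) fun t ht => hne w hw t ht) (by fun_prop)
  have hcont' : ContinuousOn (F' w₀) (Set.Ici 0) := by
    refine ContinuousOn.add (ContinuousOn.mul (ContinuousOn.neg (ContinuousOn.inv₀ (by fun_prop)
      fun t ht => pow_ne_zero _ (hne w₀ hc t ht))) (by fun_prop)) ?_
    exact ContinuousOn.mul (ContinuousOn.inv₀ (by fun_prop) fun t ht => hne w₀ hc t ht)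
      (by fun_prop)
  have hexp : ∀ w ∈ Metric.ball w₀ ε, ∀ t : ℝ,
      ‖Complex.exp (-(w + t))‖ ≤ Real.exp (‖w₀‖ + ε) * Real.exp (-t) := by
    intro w hw t
    rw [Complex.norm_exp, ← Real.exp_add]
    refine Real.exp_le_exp.mpr ?_
    rw [Metric.mem_ball, dist_eq_norm] at hw
    have h1 := Complex.abs_re_le_norm w
    have h2 : ‖w‖ ≤ ‖w - w₀‖ + ‖w₀‖ := by simpa using norm_add_le (w - w₀) w₀
    simp only [Complex.neg_re, Complex.add_re, Complex.ofReal_re]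
    linarith [neg_abs_le w.re]
  have hint : MeasureTheory.IntegrableOn (fun t : ℝ => Real.exp (-t)) (Set.Ioi 0) :=
    integrableOn_exp_neg_Ioi 0
  have hb1 : ∀ w ∈ Metric.ball w₀ ε, ∀ t : ℝ, 0 ≤ t →
      ‖(w + t)⁻¹ * Complex.exp (-(w + t))‖ ≤ ε⁻¹ * (Real.exp (‖w₀‖ + ε) * Real.exp (-t)) := by
    intro w hw t ht
    rw [norm_mul, norm_inv]
    gcongr
    · exact hlow w hw t ht
    · exact hexp w hw t
  have hb2 : ∀ w ∈ Metric.ball w₀ ε, ∀ t : ℝ, 0 ≤ t →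
      ‖F' w t‖ ≤ ((ε ^ 2)⁻¹ + ε⁻¹) * (Real.exp (‖w₀‖ + ε) * Real.exp (-t)) := by
    intro w hw t ht
    rw [add_mul]
    refine (norm_add_le _ _).trans (add_le_add ?_ ?_)
    · rw [norm_mul, norm_neg, norm_inv, norm_pow]
      gcongr
      · exact hlow w hw t ht
      · exact hexp w hw t
    · rw [mul_neg_one, mul_neg, norm_neg]
      exact hb1 w hw t ht
  have key := hasDerivAt_integral_of_dominated_loc_of_deriv_le
    (μ := MeasureTheory.volume.restrict (Set.Ioi (0 : ℝ))) (x₀ := w₀)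
    (F := fun (w : ℂ) (t : ℝ) => (w + t)⁻¹ * Complex.exp (-(w + t))) (F' := F')
    (bound := fun t => ((ε ^ 2)⁻¹ + ε⁻¹) * (Real.exp (‖w₀‖ + ε) * Real.exp (-t)))
    (Metric.ball_mem_nhds w₀ hε) ?_ ?_ ?_ ?_ ?_ ?_
  · have hval : ∫ t in Set.Ioi (0 : ℝ), F' w₀ t = 0 - (w₀ + (0 : ℝ))⁻¹ *
        Complex.exp (-(w₀ + (0 : ℝ))) := by
      refine MeasureTheory.integral_Ioi_of_hasDerivAt_of_tendsto'
        (f := fun t : ℝ => (w₀ + t)⁻¹ * Complex.exp (-(w₀ + t))) ?_ key.1 ?_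
      · intro t ht
        have h1 := hasDerivAt_inv_mul_exp_neg (hne w₀ hc t ht)
        have h2 : HasDerivAt (fun t : ℝ => w₀ + (t : ℂ)) 1 t :=
          Complex.ofRealCLM.hasDerivAt.const_add w₀
        have := h1.comp t h2
        rw [mul_one] at this
        exact this
      · refine squeeze_zero_norm' (a := fun t => ε⁻¹ * (Real.exp (‖w₀‖ + ε) * Real.exp (-t))) ?_ ?_
        · filter_upwards [eventually_ge_atTop 0] with t ht using hb1 w₀ hc t ht
        · have := (Real.tendsto_exp_neg_atTop_nhds_zero.const_mul
            (Real.exp (‖w₀‖ + ε))).const_mul ε⁻¹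
          simpa using this
    have h := key.2
    rw [hval] at h
    have heq : upperGamma 0 =
        fun w : ℂ => ∫ t in Set.Ioi (0 : ℝ), (w + t)⁻¹ * Complex.exp (-(w + t)) :=
      funext upperGamma_zero
    rw [heq]
    simpa using h
  · filter_upwards [Metric.ball_mem_nhds w₀ hε] with w hw
    exact ((hcont w hw).mono Set.Ioi_subset_Ici_self).aestronglyMeasurable measurableSet_Ioi
  · refine MeasureTheory.Integrable.mono' ((hint.const_mul (Real.exp (‖w₀‖ + ε))).const_mul ε⁻¹)
      (((hcont w₀ hc).mono Set.Ioi_subset_Ici_self).aestronglyMeasurable measurableSet_Ioi) ?_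
    filter_upwards [MeasureTheory.ae_restrict_mem measurableSet_Ioi] with t ht
    exact hb1 w₀ hc t (le_of_lt ht)
  · exact (hcont'.mono Set.Ioi_subset_Ici_self).aestronglyMeasurable measurableSet_Ioi
  · filter_upwards [MeasureTheory.ae_restrict_mem measurableSet_Ioi] with t ht w hw
    exact hb2 w hw t (le_of_lt ht)
  · exact (hint.const_mul _).const_mul _
  · filter_upwards [MeasureTheory.ae_restrict_mem measurableSet_Ioi] with t ht w hw
    exact HasDerivAt.comp_add_const w (t : ℂ)
      (hasDerivAt_inv_mul_exp_neg (hne w hw t (le_of_lt ht)))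

theorem hasDerivAt_exp_ofReal_mul (ζ : ℂ) (s : ℝ) :
    HasDerivAt (fun s : ℝ => Complex.exp (s * ζ)) (Complex.exp (s * ζ) * ζ) s := by
  have h : HasDerivAt (fun s : ℝ => (s : ℂ) * ζ) (1 * ζ) s :=
    Complex.ofRealCLM.hasDerivAt.mul_const ζ
  rw [one_mul] at h
  exact h.cexp

/-- On the strip `|Im ζ| < π` the continuation to the Riemann surface of the logarithm is the
principal branch. -/
theorem upperGammaOfLog_zero_eq {ζ : ℂ} (h1 : -Real.pi < ζ.im) (h2 : ζ.im < Real.pi) :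
    upperGammaOfLog 0 ζ = upperGamma 0 (Complex.exp ζ) := by
  -- The segment from 0 to ζ stays in the strip, so its image under exp never meets the cut.
  have hslit : ∀ s ∈ Set.uIcc (0 : ℝ) 1, Complex.exp (s * ζ) ∈ Complex.slitPlane := by
    intro s hs
    rw [Set.uIcc_of_le zero_le_one] at hs
    have him : ((s : ℂ) * ζ).im = s * ζ.im := by simp
    have h3 : -Real.pi < s * ζ.im := by nlinarith [hs.1, hs.2, Real.pi_pos]
    have h4 : s * ζ.im < Real.pi := by nlinarith [hs.1, hs.2, Real.pi_pos]
    refine Complex.mem_slitPlane_iff_arg.mpr ⟨?_, Complex.exp_ne_zero _⟩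
    rw [← Complex.log_im, Complex.log_exp (by rwa [him]) (by rw [him]; exact h4.le), him]
    exact h4.ne
  have hFTC := intervalIntegral.integral_eq_sub_of_hasDerivAt (a := 0) (b := 1)
    (f := fun s : ℝ => upperGamma 0 (Complex.exp (s * ζ)))
    (f' := fun s : ℝ => -ζ * Complex.exp (0 * (s * ζ) - Complex.exp (s * ζ))) ?_ ?_
  · rw [intervalIntegral.integral_const_mul] at hFTC
    simp only [Complex.ofReal_one, one_mul, Complex.ofReal_zero, zero_mul, Complex.exp_zero] at hFTC
    rw [upperGammaOfLog]
    simp only [zero_mul]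
    linear_combination hFTC
  · intro s hs
    have := (hasDerivAt_upperGamma_zero (hslit s hs)).comp s (hasDerivAt_exp_ofReal_mul ζ s)
    refine this.congr_deriv ?_
    have := Complex.exp_ne_zero (s * ζ)
    rw [zero_mul, zero_sub]
    field_simp
  · exact Continuous.intervalIntegrable (by fun_prop) _ _

/-- The series `∑ H_n w^n / n!`. -/
def harmonicExp (w : ℂ) : ℂ := ∑' n : ℕ, (harmonic n : ℂ) * w ^ n / n.factorial

/-- The complementary exponential integral `∫_0^w (1 - e^{-t}) / t dt`. -/
def einIntegral (w : ℂ) : ℂ := Complex.exp (-w) * harmonicExp w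

theorem norm_harmonic_le (n : ℕ) : ‖(harmonic n : ℂ)‖ ≤ n := by
  induction n with
  | zero => simp
  | succ n ih =>
    rw [harmonic_succ]
    push_cast
    refine (norm_add_le _ _).trans (add_le_add ih ?_)
    rw [norm_inv]
    refine inv_le_one_of_one_le₀ ?_
    rw [← Nat.cast_succ, Complex.norm_natCast]
    simp

theorem harmonicExp_spec (w : ℂ) :
    (Summable fun n : ℕ => (harmonic n : ℂ) * w ^ n / n.factorial) ∧
      DifferentiableAt ℂ harmonicExp w ∧
      w * (deriv harmonicExp w - harmonicExp w) = Complex.exp w - 1 := by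
  -- The ratio H_{n+1}/H_n is at most 2 for n ≥ 1. Since H_0 = 0, the recurrence is only required
  -- from n = 1; at n = 0 the ratio is 0 by the convention for division.
  have key := hasSum_deriv_of_recurrence
    (F := fun n w => (harmonic n : ℂ) * w ^ n / n.factorial)
    (a := fun _ _ => 1) (b := fun _ _ => 1)
    (g := fun n w => w * (n + 1) * (harmonic (n + 1) / harmonic n))
    (c := w) (R := 1) (M := 1) (W := (‖w‖ + 1) * 2) one_pos ?_ 1 (by positivity) ?_ ?_ ?_ ?_
  · have hs := (key.1 w (Metric.mem_ball_self (by norm_num))).of_norm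
    refine ⟨hs, key.2.1, ?_⟩
    have hd : ∀ n : ℕ, deriv (fun w : ℂ => (harmonic n : ℂ) * w ^ n / n.factorial) w =
        (harmonic n : ℂ) * (n * w ^ (n - 1)) / n.factorial := by
      intro n
      exact (((hasDerivAt_pow n w).const_mul _).div_const _).deriv
    have hsum := key.2.2
    simp only [hd] at hsum
    rw [← hasSum_nat_add_iff' 1] at hsum
    simp only [Finset.range_one, Finset.sum_singleton, harmonic_zero, Rat.cast_zero, zero_mul,
      zero_div, sub_zero] at hsum
    have hsub := (hsum.sub hs.hasSum).mul_left w
    have he : HasSum (fun n : ℕ => w ^ n / n.factorial) (Complex.exp w) := by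
      rw [Complex.exp_eq_exp_ℂ]
      exact NormedSpace.expSeries_div_hasSum_exp w
    rw [← hasSum_nat_add_iff' 1] at he
    simp only [Finset.range_one, Finset.sum_singleton, pow_zero, Nat.factorial_zero, Nat.cast_one,
      div_one] at he
    refine HasSum.unique (f := fun n : ℕ => w ^ (n + 1) / (n + 1).factorial) ?_ he
    refine hsub.congr_fun fun n => ?_
    have e1 : (n.factorial : ℂ) ≠ 0 := by exact_mod_cast n.factorial_ne_zero
    have e2 : (n : ℂ) + 1 ≠ 0 := by exact_mod_cast n.succ_ne_zero
    rw [harmonic_succ, Nat.factorial_succ, Nat.add_sub_cancel]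
    push_cast
    field_simp
    ring
  · intro n
    fun_prop
  · intro n w _; simp
  · intro n w _; simp
  · intro n x hx
    have hx' : ‖x - w‖ < 1 := by simpa [dist_eq_norm] using hx
    have h2 : ‖x‖ ≤ ‖x - w‖ + ‖w‖ := by simpa using norm_add_le (x - w) w
    have h3 : ‖(harmonic (n + 1) : ℂ) / harmonic n‖ ≤ 2 := by
      rcases Nat.eq_zero_or_pos n with rfl | hn
      · simp
      · have hpos : (1 : ℝ) ≤ ‖(harmonic n : ℂ)‖ := by
          have h1 : (1 : ℚ) ≤ harmonic n := by
            obtain ⟨k, rfl⟩ := Nat.exists_eq_add_of_le' hn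
            induction k with
            | zero => simp [harmonic]
            | succ k ih =>
              rw [harmonic_succ]
              have : (0 : ℚ) ≤ ((k + 1 : ℕ) + 1 : ℚ)⁻¹ := by positivity
              have := ih (by omega)
              push_cast at *
              linarith
          have h2 : (1 : ℝ) ≤ ((harmonic n : ℚ) : ℝ) := by exact_mod_cast h1
          have h3 : ((harmonic n : ℚ) : ℂ) = (((harmonic n : ℚ) : ℝ) : ℂ) := by simp
          rw [h3, Complex.norm_real, Real.norm_eq_abs]
          exact h2.trans (le_abs_self _)
        rw [norm_div, div_le_iff₀ (by linarith), harmonic_succ]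
        push_cast
        refine (norm_add_le _ _).trans ?_
        have : ‖((n : ℂ) + 1)⁻¹‖ ≤ 1 := by
          rw [norm_inv]
          refine inv_le_one_of_one_le₀ ?_
          rw [← Nat.cast_succ, Complex.norm_natCast]
          simp
        linarith
    rw [norm_mul, norm_mul, ← Nat.cast_succ, Complex.norm_natCast, Nat.cast_succ]
    calc _ ≤ (‖w‖ + 1) * (n + 1 : ℝ) * 2 := by gcongr; linarith
      _ = _ := by ring
  · intro n hn x _
    have hpos : (harmonic n : ℂ) ≠ 0 := by
      exact_mod_cast (harmonic_pos (by omega)).ne'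
    have e1 : (n.factorial : ℂ) ≠ 0 := by exact_mod_cast n.factorial_ne_zero
    have e2 : (n : ℂ) + 1 ≠ 0 := by exact_mod_cast n.succ_ne_zero
    simp only [Nat.factorial_succ]
    push_cast
    field_simp
    ring

/-- The second part is the differential equation that identifies e^{-w} ∑ H_n w^n / n! as the
complementary exponential integral; it rests on H_{n+1} - H_n = 1/(n+1). -/
theorem hasDerivAt_einIntegral (w : ℂ) :
    HasDerivAt einIntegral (deriv einIntegral w) w ∧
      w * deriv einIntegral w = 1 - Complex.exp (-w) := by
  obtain ⟨_, h1, h2⟩ := harmonicExp_spec w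
  have h3 := (hasDerivAt_neg w).cexp.mul h1.hasDerivAt
  have h4 : HasDerivAt einIntegral _ w := h3
  refine ⟨h4.differentiableAt.hasDerivAt, ?_⟩
  rw [h4.deriv]
  have h5 : Complex.exp (-w) * Complex.exp w = 1 := by rw [← Complex.exp_add]; simp
  linear_combination Complex.exp (-w) * h2 + h5

/-- Along the path u = e^{sζ} the integrand e^{-u}/u has the antiderivative log u - Ein(u), with log
u = sζ; Ein is entire, so the branch enters only through ζ. -/
theorem upperGammaOfLog_zero_eq_sub (ζ : ℂ) :
    upperGammaOfLog 0 ζ =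
      upperGamma 0 1 - einIntegral 1 - ζ + einIntegral (Complex.exp ζ) := by
  have hFTC := intervalIntegral.integral_eq_sub_of_hasDerivAt (a := 0) (b := 1)
    (f := fun s : ℝ => s * ζ - einIntegral (Complex.exp (s * ζ)))
    (f' := fun s : ℝ => ζ * Complex.exp (0 * (s * ζ) - Complex.exp (s * ζ))) ?_ ?_
  · rw [intervalIntegral.integral_const_mul] at hFTC
    simp only [Complex.ofReal_one, one_mul, Complex.ofReal_zero, zero_mul, Complex.exp_zero] at hFTC
    rw [upperGammaOfLog]
    simp only [zero_mul]
    linear_combination -hFTC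
  · intro s hs
    obtain ⟨h1, h2⟩ := hasDerivAt_einIntegral (Complex.exp (s * ζ))
    have h3 := h1.comp s (hasDerivAt_exp_ofReal_mul ζ s)
    have h4 : HasDerivAt (fun s : ℝ => (s : ℂ) * ζ) (1 * ζ) s :=
      Complex.ofRealCLM.hasDerivAt.mul_const ζ
    refine (h4.sub h3).congr_deriv ?_
    rw [zero_mul, zero_sub]
    linear_combination -ζ * h2
  · exact Continuous.intervalIntegrable (by fun_prop) _ _

theorem integral_log_mul_exp_neg :
    ∫ t in Set.Ioi (0 : ℝ), (Real.log t : ℂ) * Real.exp (-t) = -Real.eulerMascheroniConstant := by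
  have h1 := Complex.hasDerivAt_GammaIntegral (s := 1) (by simp)
  have h2 : Complex.Gamma =ᶠ[𝓝 1] Complex.GammaIntegral := by
    have : ∀ᶠ s : ℂ in 𝓝 1, 0 < s.re :=
      Complex.continuous_re.continuousAt.eventually (lt_mem_nhds (by simp))
    filter_upwards [this] with s hs using Complex.Gamma_eq_integral hs
  have h3 := (h1.congr_of_eventuallyEq h2).unique Complex.hasDerivAt_Gamma_one
  simpa using h3

theorem integrableOn_log_mul_exp_neg :
    MeasureTheory.IntegrableOn (fun t : ℝ => (Real.log t : ℂ) * Real.exp (-t)) (Set.Ioi 0) := by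
  -- A nonintegrable function has integral 0 by convention, so the nonzero value -γ already forces
  -- integrability.
  refine MeasureTheory.Integrable.of_integral_ne_zero ?_
  rw [integral_log_mul_exp_neg, neg_ne_zero]
  have := Real.one_half_lt_eulerMascheroniConstant
  exact_mod_cast (show Real.eulerMascheroniConstant ≠ 0 by linarith)

theorem norm_upperGamma_zero_le {t : ℝ} (ht : 1 ≤ t) : ‖upperGamma 0 t‖ ≤ Real.exp (-t) := by
  rw [upperGamma_zero]
  have hint : MeasureTheory.IntegrableOn (fun s : ℝ => Real.exp (-t) * Real.exp (-s)) (Set.Ioi 0) :=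
    (integrableOn_exp_neg_Ioi 0).const_mul _
  refine (MeasureTheory.norm_integral_le_of_norm_le hint ?_).trans ?_
  · filter_upwards [MeasureTheory.ae_restrict_mem measurableSet_Ioi] with s hs
    have hs' : (0 : ℝ) < s := hs
    rw [← Complex.ofReal_add, ← Complex.ofReal_neg, norm_mul, norm_inv, Complex.norm_real,
      Complex.norm_exp_ofReal, ← Real.exp_add, ← neg_add, Real.norm_of_nonneg (by linarith)]
    exact mul_le_of_le_one_left (Real.exp_nonneg _) (inv_le_one_of_one_le₀ (by linarith))
  · rw [MeasureTheory.integral_const_mul, integral_exp_neg_Ioi_zero, mul_one]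

/-- The constant term of the expansion of the exponential integral at the origin. -/
theorem upperGamma_zero_one_sub : upperGamma 0 1 - einIntegral 1 = -Real.eulerMascheroniConstant := by
  -- An antiderivative of e^{-t} log t that vanishes at 0: the factor 1 - e^{-t} tames the logarithm
  -- there, and Ein cancels the term (1 - e^{-t})/t.
  set f : ℝ → ℂ := fun t => ((1 - Real.exp (-t)) * Real.log t : ℝ) - einIntegral t with hf
  have hein : ∀ t : ℝ, HasDerivAt (fun t : ℝ => einIntegral t) (deriv einIntegral t) t := fun t =>
    (hasDerivAt_einIntegral t).1.comp_ofReal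
  have hein0 : einIntegral 0 = 0 := by
    have h : ∀ n : ℕ, (harmonic n : ℂ) * 0 ^ n / n.factorial = 0 := fun n => by
      cases n <;> simp
    simp [einIntegral, harmonicExp, h]
  have hcont : ContinuousWithinAt f (Set.Ici 0) 0 := by
    refine ContinuousWithinAt.sub ?_ (hein 0).continuousAt.continuousWithinAt
    refine Complex.continuous_ofReal.continuousAt.comp_continuousWithinAt ?_
    rw [ContinuousWithinAt]
    simp only [Real.log_zero, mul_zero]
    have h0 : Tendsto (fun t : ℝ => |t * Real.log t|) (𝓝[Set.Ici 0] 0) (𝓝 0) := by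
      have := (Real.continuous_mul_log.abs.tendsto 0).mono_left
        (nhdsWithin_le_nhds (s := Set.Ici 0))
      simpa using this
    refine squeeze_zero_norm' ?_ h0
    filter_upwards [self_mem_nhdsWithin] with t ht
    have ht' : (0 : ℝ) ≤ t := ht
    rw [Real.norm_eq_abs, abs_mul, abs_mul, abs_of_nonneg ht',
      abs_of_nonneg (by simpa using ht')]
    gcongr
    linarith [Real.one_sub_le_exp_neg t]
  have hderiv : ∀ t ∈ Set.Ioi (0 : ℝ), HasDerivAt f ((Real.log t : ℂ) * Real.exp (-t)) t := by
    intro t ht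
    have ht0 : t ≠ 0 := (show (0 : ℝ) < t from ht).ne'
    have h1 : HasDerivAt (fun t : ℝ => (1 - Real.exp (-t)) * Real.log t)
        (-(Real.exp (-t) * -1) * Real.log t + (1 - Real.exp (-t)) * t⁻¹) t :=
      (((hasDerivAt_neg t).exp).const_sub 1).mul (Real.hasDerivAt_log ht0)
    refine (h1.ofReal_comp.sub (hein t)).congr_deriv ?_
    have h2 := (hasDerivAt_einIntegral t).2
    have ht1 : (t : ℂ) ≠ 0 := by exact_mod_cast ht0
    refine mul_left_cancel₀ ht1 ?_
    push_cast
    have h3 : (t : ℂ) * (t : ℂ)⁻¹ = 1 := mul_inv_cancel₀ ht1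
    linear_combination -h2 + (1 - Complex.exp (-t)) * h3
  -- With c the constant sought, Γ(0,t) = c - log t + Ein(t) for t > 0, so f(t) = c - e^{-t} log t -
  -- Γ(0,t). Hence c is the integral of f', that is Γ'(1) = -γ.
  have hlim : Tendsto f atTop (𝓝 (upperGamma 0 1 - einIntegral 1)) := by
    have heq : ∀ᶠ t : ℝ in atTop, upperGamma 0 1 - einIntegral 1 -
        ((Real.exp (-t) * Real.log t : ℝ) + upperGamma 0 t) = f t := by
      filter_upwards [eventually_gt_atTop 0] with t ht
      have h1 := upperGammaOfLog_zero_eq (ζ := (Real.log t : ℂ)) (by simp [Real.pi_pos])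
        (by simp [Real.pi_pos])
      rw [upperGammaOfLog_zero_eq_sub, ← Complex.ofReal_exp, Real.exp_log ht] at h1
      simp only [hf]
      push_cast
      linear_combination h1
    refine Tendsto.congr' heq ?_
    have h1 : Tendsto (fun t : ℝ => upperGamma 0 t) atTop (𝓝 0) := by
      refine squeeze_zero_norm' ?_ Real.tendsto_exp_neg_atTop_nhds_zero
      filter_upwards [eventually_ge_atTop 1] with t ht using norm_upperGamma_zero_le ht
    have h2 : Tendsto (fun t : ℝ => Real.exp (-t) * Real.log t) atTop (𝓝 0) := by
      have h3 := Real.tendsto_pow_mul_exp_neg_atTop_nhds_zero 1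
      refine squeeze_zero_norm' ?_ h3
      filter_upwards [eventually_ge_atTop 1] with t ht
      rw [Real.norm_eq_abs, abs_mul, abs_of_pos (Real.exp_pos _),
        abs_of_nonneg (Real.log_nonneg ht), pow_one, mul_comm]
      gcongr
      exact Real.log_le_self (by linarith)
    have h4 := (Complex.continuous_ofReal.tendsto 0).comp h2
    have h5 := (h4.add h1).const_sub (upperGamma 0 1 - einIntegral 1)
    simpa using h5
  have h := MeasureTheory.integral_Ioi_of_hasDerivAt_of_tendsto hcont hderiv
    integrableOn_log_mul_exp_neg hlim
  rw [integral_log_mul_exp_neg] at h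
  rw [h]
  simp [hf, hein0]

/-- The expansion of the exponential integral on the Riemann surface of the logarithm. -/
theorem upperGammaOfLog_zero_expansion (ζ : ℂ) :
    upperGammaOfLog 0 ζ = -Real.eulerMascheroniConstant - ζ + einIntegral (Complex.exp ζ) := by
  rw [upperGammaOfLog_zero_eq_sub, upperGamma_zero_one_sub]

/-! ### Cosine moments of powers of 1 + cos θ -/

theorem one_add_cos_pos {θ : ℝ} (hθ : θ ∈ Set.Ioo 0 Real.pi) : 0 < 1 + Real.cos θ := by
  have := Real.cos_lt_cos_of_nonneg_of_le_pi hθ.1.le le_rfl hθ.2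
  rw [Real.cos_pi] at this
  linarith

theorem one_sub_cos_pos {θ : ℝ} (hθ : θ ∈ Set.Ioo 0 Real.pi) : 0 < 1 - Real.cos θ := by
  have := Real.cos_lt_cos_of_nonneg_of_le_pi le_rfl hθ.2.le hθ.1
  rw [Real.cos_zero] at this
  linarith

theorem image_one_add_cos_div_two :
    (fun θ : ℝ => (1 + Real.cos θ) / 2) '' Set.Ioo 0 Real.pi = Set.Ioo 0 1 := by
  ext x
  constructor
  · rintro ⟨θ, hθ, rfl⟩
    have h1 := one_add_cos_pos hθ
    have h2 := one_sub_cos_pos hθ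
    constructor <;> dsimp only <;> linarith
  · intro hx
    refine ⟨Real.arccos (2 * x - 1), ⟨?_, ?_⟩, ?_⟩
    · rw [Real.arccos_pos]; linarith [hx.2]
    · refine lt_of_le_of_ne (Real.arccos_le_pi _) fun h => ?_
      rw [Real.arccos_eq_pi] at h
      linarith [hx.1]
    · dsimp only
      rw [Real.cos_arccos (by linarith [hx.1]) (by linarith [hx.2])]
      ring

/-- Under x = (1 + cos θ)/2 the Jacobian sin θ / 2 is √(x(1 - x)), which cancels the half-powers of
the beta integrand. -/
theorem sin_mul_beta_integrand {s : ℂ} {θ : ℝ} (hθ : θ ∈ Set.Ioo 0 Real.pi) :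
    |(-Real.sin θ / 2)| • ((((1 + Real.cos θ) / 2 : ℝ) : ℂ) ^ (s + 1 / 2 - 1) *
      (1 - (((1 + Real.cos θ) / 2 : ℝ) : ℂ)) ^ ((1 / 2 : ℂ) - 1)) =
      2 ^ (-s) * ((1 + Real.cos θ : ℝ) : ℂ) ^ s := by
  have h1 := one_add_cos_pos hθ
  have h2 := one_sub_cos_pos hθ
  have hsin := Real.sin_pos_of_pos_of_lt_pi hθ.1 hθ.2
  set X : ℝ := (1 + Real.cos θ) / 2 with hX
  set Y : ℝ := (1 - Real.cos θ) / 2 with hY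
  have hX0 : 0 < X := by positivity
  have hY0 : 0 < Y := by positivity
  have hXc : (X : ℂ) ≠ 0 := by exact_mod_cast hX0.ne'
  have hYc : (Y : ℂ) ≠ 0 := by exact_mod_cast hY0.ne'
  have habs : |(-Real.sin θ / 2)| = X ^ (1 / 2 : ℝ) * Y ^ (1 / 2 : ℝ) := by
    rw [← Real.mul_rpow hX0.le hY0.le, ← Real.sqrt_eq_rpow, eq_comm,
      Real.sqrt_eq_iff_mul_self_eq (by positivity) (abs_nonneg _), abs_mul_abs_self]
    have := Real.sin_sq_add_cos_sq θ
    rw [hX, hY]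
    linear_combination (-1 / 4) * this
  have hYe : 1 - (X : ℂ) = Y := by
    rw [hX, hY]; push_cast; ring
  have h2X : ((1 + Real.cos θ : ℝ) : ℂ) ^ s = 2 ^ s * (X : ℂ) ^ s := by
    rw [show (1 + Real.cos θ : ℝ) = 2 * X by rw [hX]; ring, Complex.ofReal_mul,
      Complex.mul_cpow_ofReal_nonneg (by norm_num) hX0.le]
    norm_num
  rw [habs, hYe, h2X, Complex.real_smul, Complex.ofReal_mul, Complex.ofReal_cpow hX0.le,
    Complex.ofReal_cpow hY0.le, ← mul_assoc (2 ^ (-s)), ← Complex.cpow_add _ _ two_ne_zero]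
  rw [neg_add_cancel, Complex.cpow_zero, one_mul]
  push_cast
  have e1 : (X : ℂ) ^ (1 / 2 : ℂ) * (X : ℂ) ^ (s + 1 / 2 - 1) = (X : ℂ) ^ s := by
    rw [← Complex.cpow_add _ _ hXc]; ring_nf
  have e2 : (Y : ℂ) ^ (1 / 2 : ℂ) * (Y : ℂ) ^ ((1 / 2 : ℂ) - 1) = 1 := by
    rw [← Complex.cpow_add _ _ hYc]; norm_num
  linear_combination (Y : ℂ) ^ (1 / 2 : ℂ) * (Y : ℂ) ^ ((1 / 2 : ℂ) - 1) * e1 + (X : ℂ) ^ s * e2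

theorem hasDerivWithinAt_one_add_cos_div_two (θ : ℝ) (t : Set ℝ) :
    HasDerivWithinAt (fun θ : ℝ => (1 + Real.cos θ) / 2) (-Real.sin θ / 2) t θ :=
  (((Real.hasDerivAt_cos θ).const_add 1).div_const 2).hasDerivWithinAt

theorem injOn_one_add_cos_div_two :
    Set.InjOn (fun θ : ℝ => (1 + Real.cos θ) / 2) (Set.Ioo 0 Real.pi) := by
  intro a ha b hb h
  refine Real.injOn_cos ⟨ha.1.le, ha.2.le⟩ ⟨hb.1.le, hb.2.le⟩ ?_
  dsimp only at h
  linarith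

theorem integrableOn_one_add_cos_cpow {s : ℂ} (hs : -(1 / 2) < s.re) :
    MeasureTheory.IntegrableOn (fun θ : ℝ => ((1 + Real.cos θ : ℝ) : ℂ) ^ s)
      (Set.Ioo 0 Real.pi) := by
  have hb := Complex.betaIntegral_convergent (u := s + 1 / 2) (v := 1 / 2)
    (by simp; linarith) (by norm_num)
  rw [intervalIntegrable_iff_integrableOn_Ioo_of_le zero_le_one, ← image_one_add_cos_div_two,
    MeasureTheory.integrableOn_image_iff_integrableOn_abs_deriv_smul measurableSet_Ioo
      (fun θ _ => hasDerivWithinAt_one_add_cos_div_two θ _) injOn_one_add_cos_div_two] at hb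
  have h2 : (2 : ℂ) ^ (-s) ≠ 0 := by simp [Complex.cpow_eq_zero_iff]
  have hb' := hb.const_mul ((2 : ℂ) ^ (-s))⁻¹
  refine MeasureTheory.Integrable.congr hb' ?_
  filter_upwards [MeasureTheory.ae_restrict_mem measurableSet_Ioo] with θ hθ
  rw [sin_mul_beta_integrand hθ, inv_mul_cancel_left₀ h2]

theorem integral_one_add_cos_cpow (s : ℂ) :
    ∫ θ in Set.Ioo 0 Real.pi, ((1 + Real.cos θ : ℝ) : ℂ) ^ s =
      2 ^ s * Complex.betaIntegral (s + 1 / 2) (1 / 2) := by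
  rw [Complex.betaIntegral, intervalIntegral.integral_of_le zero_le_one,
    MeasureTheory.integral_Ioc_eq_integral_Ioo, ← image_one_add_cos_div_two,
    MeasureTheory.integral_image_eq_integral_abs_deriv_smul measurableSet_Ioo
      (fun θ _ => hasDerivWithinAt_one_add_cos_div_two θ _) injOn_one_add_cos_div_two,
    ← MeasureTheory.integral_const_mul]
  refine MeasureTheory.setIntegral_congr_fun measurableSet_Ioo fun θ hθ => ?_
  rw [sin_mul_beta_integrand hθ, ← mul_assoc, ← Complex.cpow_add _ _ two_ne_zero]
  simp

/-- The cosine moments `∫_0^π (1 + cos θ)^s cos mθ dθ`. -/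
def cosineMoment (m : ℕ) (s : ℂ) : ℂ :=
  ∫ θ in (0 : ℝ)..Real.pi, ((1 + Real.cos θ : ℝ) : ℂ) ^ s * (Real.cos (m * θ) : ℂ)

theorem intervalIntegrable_one_add_cos_cpow {s : ℂ} (hs : -(1 / 2) < s.re) :
    IntervalIntegrable (fun θ : ℝ => ((1 + Real.cos θ : ℝ) : ℂ) ^ s)
      MeasureTheory.volume 0 Real.pi := by
  rw [intervalIntegrable_iff_integrableOn_Ioo_of_le Real.pi_pos.le]
  exact integrableOn_one_add_cos_cpow hs

theorem intervalIntegrable_cosineMoment (m : ℕ) {s : ℂ} (hs : -(1 / 2) < s.re) :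
    IntervalIntegrable (fun θ : ℝ => ((1 + Real.cos θ : ℝ) : ℂ) ^ s * (Real.cos (m * θ) : ℂ))
      MeasureTheory.volume 0 Real.pi :=
  (intervalIntegrable_one_add_cos_cpow hs).mul_continuousOn (by fun_prop)

theorem cos_half_pos {θ : ℝ} (hθ : θ ∈ Set.Ioo 0 Real.pi) : 0 < Real.cos (θ / 2) :=
  Real.cos_pos_of_mem_Ioo ⟨by linarith [hθ.1, Real.pi_pos], by linarith [hθ.2]⟩

theorem one_add_cos_cpow_eq {s : ℂ} {θ : ℝ} (hθ : θ ∈ Set.Ioo 0 Real.pi) :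
    ((1 + Real.cos θ : ℝ) : ℂ) ^ s = 2 ^ s * (Real.cos (θ / 2) : ℂ) ^ (2 * s) := by
  have h := cos_half_pos hθ
  have h1 : 1 + Real.cos θ = 2 * (Real.cos (θ / 2) * Real.cos (θ / 2)) := by
    have := Real.cos_sq (θ / 2)
    rw [mul_div_cancel₀ _ two_ne_zero] at this
    linear_combination -2 * this
  rw [h1, Complex.ofReal_mul, Complex.mul_cpow_ofReal_nonneg (by norm_num) (by positivity),
    Complex.ofReal_mul, Complex.mul_cpow_ofReal_nonneg h.le h.le, two_mul s,
    Complex.cpow_add _ _ (by exact_mod_cast h.ne')]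
  norm_num

theorem cosineMoment_succ (m : ℕ) {s : ℂ} (hs : -(1 / 2) < s.re) :
    (s + m + 1) * cosineMoment (m + 1) s = (s - m) * cosineMoment m s := by
  -- This product vanishes at both ends: at 0 by the sine, at π because Re(2s + 1) > 0. Its
  -- derivative combines the integrands for m + 1 and m, so integrating it gives the recurrence.
  set W : ℝ → ℂ := fun θ => (Real.cos (θ / 2) : ℂ) ^ (2 * s + 1) *
    (Real.sin ((2 * m + 1) * (θ / 2)) : ℂ) with hW
  have hre : 0 < (2 * s + 1).re := by simp; linarith
  have hne : 2 * s + 1 ≠ 0 := fun h => by rw [h] at hre; simp at hre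
  have hcont : ContinuousOn W (Set.Icc 0 Real.pi) := by
    refine Continuous.continuousOn (Continuous.mul ?_ (by fun_prop))
    exact (Complex.continuous_ofReal_cpow_const hre).comp (by fun_prop)
  set D : ℝ → ℂ := fun θ => (2 ^ s)⁻¹ / 4 * (2 * (s + m + 1) * (((1 + Real.cos θ : ℝ) : ℂ) ^ s *
    (Real.cos ((m + 1 : ℕ) * θ) : ℂ)) - 2 * (s - m) * (((1 + Real.cos θ : ℝ) : ℂ) ^ s *
      (Real.cos (m * θ) : ℂ))) with hD
  have hI1 := (intervalIntegrable_cosineMoment (m + 1) hs).const_mul (2 * (s + m + 1))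
  have hI2 := (intervalIntegrable_cosineMoment m hs).const_mul (2 * (s - m))
  have hderiv : ∀ θ ∈ Set.Ioo 0 Real.pi, HasDerivAt W (D θ) θ := by
    intro θ hθ
    have hq := cos_half_pos hθ
    have hqc : (Real.cos (θ / 2) : ℂ) ≠ 0 := by exact_mod_cast hq.ne'
    have hc : HasDerivAt (fun θ : ℝ => Real.cos (θ / 2)) (-Real.sin (θ / 2) * (1 / 2)) θ :=
      ((hasDerivAt_id θ).div_const 2).cos
    have hp : HasDerivAt (fun θ : ℝ => (Real.cos (θ / 2) : ℂ) ^ (2 * s + 1))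
        ((2 * s + 1) * (Real.cos (θ / 2) : ℂ) ^ (2 * s + 1 - 1) *
          ((-Real.sin (θ / 2) * (1 / 2) : ℝ) : ℂ)) θ := by
      have h1 : HasDerivAt (fun x : ℂ => x ^ (2 * s + 1)) _ (Real.cos (θ / 2) : ℂ) :=
        (hasDerivAt_id _).cpow_const (Complex.ofReal_mem_slitPlane.mpr hq)
      have := h1.comp θ hc.ofReal_comp
      refine this.congr_deriv ?_
      simp
    have hsn : HasDerivAt (fun θ : ℝ => Real.sin ((2 * m + 1) * (θ / 2)))
        (Real.cos ((2 * m + 1) * (θ / 2)) * ((2 * m + 1) * (1 / 2))) θ :=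
      (((hasDerivAt_id θ).div_const 2).const_mul (2 * (m : ℝ) + 1)).sin
    refine (hp.mul hsn.ofReal_comp).congr_deriv ?_
    have hadd : (Real.cos (θ / 2) : ℂ) ^ (2 * s + 1) =
        (Real.cos (θ / 2) : ℂ) ^ (2 * s) * Real.cos (θ / 2) := by
      rw [Complex.cpow_add _ _ hqc, Complex.cpow_one]
    have c1 : Real.cos ((m + 1 : ℕ) * θ) = Real.cos ((2 * m + 1) * (θ / 2)) * Real.cos (θ / 2) -
        Real.sin ((2 * m + 1) * (θ / 2)) * Real.sin (θ / 2) := by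
      rw [← Real.cos_add]; push_cast; ring_nf
    have c2 : Real.cos (m * θ) = Real.cos ((2 * m + 1) * (θ / 2)) * Real.cos (θ / 2) +
        Real.sin ((2 * m + 1) * (θ / 2)) * Real.sin (θ / 2) := by
      rw [← Real.cos_sub]; ring_nf
    have h2 : (2 : ℂ) ^ s ≠ 0 := by simp [Complex.cpow_eq_zero_iff]
    simp only [hD]
    rw [one_add_cos_cpow_eq hθ, c1, c2, hadd, add_sub_cancel_right]
    generalize Real.cos ((2 * m + 1) * (θ / 2)) = A
    generalize Real.sin ((2 * m + 1) * (θ / 2)) = B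
    push_cast
    field_simp
    ring
  have hFTC := intervalIntegral.integral_eq_sub_of_hasDerivAt_of_le Real.pi_pos.le hcont hderiv
    ((hI1.sub hI2).const_mul _)
  have h0 : W Real.pi - W 0 = 0 := by
    simp only [hW]
    rw [Real.cos_pi_div_two, Complex.ofReal_zero, Complex.zero_cpow hne]
    simp
  have h2 : ((2 : ℂ) ^ s)⁻¹ / 4 ≠ 0 := by simp [Complex.cpow_eq_zero_iff]
  rw [h0] at hFTC
  simp only [hD] at hFTC
  rw [intervalIntegral.integral_const_mul, intervalIntegral.integral_sub hI1 hI2,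
    intervalIntegral.integral_const_mul, intervalIntegral.integral_const_mul] at hFTC
  have h3 := (mul_eq_zero.mp hFTC).resolve_left h2
  unfold cosineMoment
  linear_combination h3 / 2

/-- For m = 0 this is a beta integral; the step in m is the functional equation of 1/Γ applied to
the moment recurrence. -/
theorem cosineMoment_eq (m : ℕ) {s : ℂ} (hs : -(1 / 2) < s.re) :
    cosineMoment m s = (Real.sqrt Real.pi : ℂ) * 2 ^ s * Complex.Gamma (s + 1 / 2) *
      Complex.Gamma (s + 1) * rGamma (s + m + 1) * rGamma (s - m + 1) := by
  induction m with
  | zero =>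
    have h1 := integral_one_add_cos_cpow s
    have h2 := Complex.Gamma_mul_Gamma_eq_betaIntegral (s := s + 1 / 2) (t := 1 / 2)
      (by simp; linarith) (by norm_num)
    have h3 : Complex.Gamma (s + 1) ≠ 0 := Complex.Gamma_ne_zero_of_re_pos (by simp; linarith)
    have hpi : Complex.Gamma (1 / 2) = (Real.sqrt Real.pi : ℂ) := by
      rw [Complex.Gamma_one_half_eq, Real.sqrt_eq_rpow, Complex.ofReal_cpow Real.pi_pos.le]
      norm_num
    rw [show s + 1 / 2 + 1 / 2 = s + 1 by ring, hpi] at h2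
    unfold cosineMoment
    simp only [Nat.cast_zero, zero_mul, Real.cos_zero, Complex.ofReal_one, mul_one, add_zero,
      sub_zero]
    rw [intervalIntegral.integral_of_le Real.pi_pos.le, MeasureTheory.integral_Ioc_eq_integral_Ioo,
      h1, rGamma]
    generalize Complex.betaIntegral (s + 1 / 2) (1 / 2) = B at *
    generalize Complex.Gamma (s + 1 / 2) = A at *
    field_simp
    linear_combination -h2
  | succ m ih =>
    have hne : s + m + 1 ≠ 0 := by
      intro h
      have := congrArg Complex.re h
      simp at this
      linarith [(Nat.cast_nonneg m : (0 : ℝ) ≤ m)]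
    refine mul_left_cancel₀ hne ?_
    rw [cosineMoment_succ m hs, ih]
    push_cast
    rw [rGamma_eq_mul (s + m + 1), show s - (m + 1 : ℂ) + 1 = s - m by ring,
      rGamma_eq_mul (s - m), show s + (m + 1 : ℂ) + 1 = s + m + 1 + 1 by ring]
    ring

/-- An integrable majorant uniform in the exponent. For g ≤ 1, write -1/8 = 1/8 - 1/4: the power 1/8
absorbs the logarithm at cost 8, and the remaining -1/4 exceeds -1/2, the integrability threshold
for 1 + cos θ. -/
theorem abs_log_mul_rpow_le {g a : ℝ} (hg : 0 < g) (hg2 : g ≤ 2) {k : ℕ}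
    (ha : |a - k| ≤ 1 / 8) : |Real.log g| * g ^ a ≤ 8 * g ^ (-(1 / 4) : ℝ) + 2 ^ (k + 1) := by
  obtain ⟨ha1, ha2⟩ := abs_le.mp ha
  have hk : (0 : ℝ) ≤ k := Nat.cast_nonneg k
  rcases le_or_gt g 1 with h1 | h1
  · have h := (Real.abs_log_mul_self_rpow_lt g (1 / 8) hg h1 (by norm_num)).le
    rw [abs_mul, abs_of_pos (Real.rpow_pos_of_pos hg _)] at h
    have h2 : g ^ a ≤ g ^ ((1 / 8 : ℝ) + -(1 / 4)) :=
      Real.rpow_le_rpow_of_exponent_ge hg h1 (by linarith)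
    rw [Real.rpow_add hg] at h2
    have h3 : (0 : ℝ) ≤ g ^ (-(1 / 4) : ℝ) := Real.rpow_nonneg hg.le _
    calc |Real.log g| * g ^ a ≤ |Real.log g| * (g ^ (1 / 8 : ℝ) * g ^ (-(1 / 4) : ℝ)) := by gcongr
      _ = |Real.log g| * g ^ (1 / 8 : ℝ) * g ^ (-(1 / 4) : ℝ) := by ring
      _ ≤ 8 * g ^ (-(1 / 4) : ℝ) := by
        gcongr
        linarith
      _ ≤ _ := le_add_of_nonneg_right (by positivity)
  · have h2 : |Real.log g| ≤ 1 := by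
      rw [abs_of_nonneg (Real.log_nonneg h1.le)]
      have := Real.log_le_sub_one_of_pos hg
      linarith
    have h3 : g ^ a ≤ 2 ^ (k + 1) := by
      calc g ^ a ≤ g ^ ((k + 1 : ℕ) : ℝ) :=
            Real.rpow_le_rpow_of_exponent_le h1.le (by push_cast; linarith)
        _ = g ^ (k + 1) := Real.rpow_natCast _ _
        _ ≤ 2 ^ (k + 1) := by gcongr
    calc |Real.log g| * g ^ a ≤ 1 * 2 ^ (k + 1) := by
          gcongr
      _ ≤ _ := by
        rw [one_mul]
        exact le_add_of_nonneg_left (by positivity)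

/-- Discards the endpoint π, where 1 + cos θ = 0 and the logarithm takes its default value. -/
theorem ae_mem_uIoc_imp_Ioo {p : ℝ → Prop} (h : ∀ θ ∈ Set.Ioo 0 Real.pi, p θ) :
    ∀ᵐ θ : ℝ, θ ∈ Set.uIoc 0 Real.pi → p θ := by
  have hne : ∀ᵐ θ : ℝ, θ ≠ Real.pi := by
    simp [MeasureTheory.ae_iff]
  filter_upwards [hne] with θ hθ hmem
  rw [Set.uIoc_of_le Real.pi_pos.le] at hmem
  exact h θ ⟨hmem.1, lt_of_le_of_ne hmem.2 hθ⟩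

theorem hasDerivAt_cosineMoment (m k : ℕ) :
    IntervalIntegrable (fun θ : ℝ => (Real.log (1 + Real.cos θ) : ℂ) *
        (((1 + Real.cos θ : ℝ) : ℂ) ^ k * (Real.cos (m * θ) : ℂ)))
      MeasureTheory.volume 0 Real.pi ∧
    HasDerivAt (cosineMoment m) (∫ θ in (0 : ℝ)..Real.pi, (Real.log (1 + Real.cos θ) : ℂ) *
        (((1 + Real.cos θ : ℝ) : ℂ) ^ k * (Real.cos (m * θ) : ℂ))) k := by
  have hk : (0 : ℝ) ≤ k := Nat.cast_nonneg k
  have hball : ∀ s ∈ Metric.ball (k : ℂ) (1 / 8), |s.re - k| ≤ 1 / 8 := by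
    intro s hs
    rw [Metric.mem_ball, dist_eq_norm] at hs
    have := Complex.abs_re_le_norm (s - k)
    simp only [Complex.sub_re, Complex.natCast_re] at this
    linarith
  have hb : IntervalIntegrable (fun θ : ℝ => 8 * (1 + Real.cos θ) ^ (-(1 / 4) : ℝ) + 2 ^ (k + 1))
      MeasureTheory.volume 0 Real.pi := by
    refine IntervalIntegrable.add (IntervalIntegrable.const_mul ?_ 8) (by simp)
    have h := (intervalIntegrable_one_add_cos_cpow (s := ((-(1 / 4) : ℝ) : ℂ))
      (by rw [Complex.ofReal_re]; norm_num)).norm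
    refine h.congr_ae ?_
    rw [EventuallyEq, MeasureTheory.ae_restrict_iff' measurableSet_uIoc]
    refine ae_mem_uIoc_imp_Ioo fun θ hθ => ?_
    rw [Complex.norm_cpow_eq_rpow_re_of_pos (one_add_cos_pos hθ), Complex.ofReal_re]
  have hmeas : Measurable fun θ : ℝ => (Real.log (1 + Real.cos θ) : ℂ) :=
    Complex.measurable_ofReal.comp (Real.measurable_log.comp (by fun_prop))
  have hmeas2 : ∀ s : ℂ, Measurable fun θ : ℝ => ((1 + Real.cos θ : ℝ) : ℂ) ^ s := fun s =>
    Measurable.pow_const (Complex.measurable_ofReal.comp (by fun_prop)) s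
  have hmeas3 : Measurable fun θ : ℝ => (Real.cos (m * θ) : ℂ) :=
    Complex.measurable_ofReal.comp (by fun_prop)
  have key := intervalIntegral.hasDerivAt_integral_of_dominated_loc_of_deriv_le
    (μ := MeasureTheory.volume) (a := 0) (b := Real.pi) (x₀ := (k : ℂ))
    (F := fun (s : ℂ) (θ : ℝ) => ((1 + Real.cos θ : ℝ) : ℂ) ^ s * (Real.cos (m * θ) : ℂ))
    (F' := fun (s : ℂ) (θ : ℝ) => (Real.log (1 + Real.cos θ) : ℂ) *
        (((1 + Real.cos θ : ℝ) : ℂ) ^ s * (Real.cos (m * θ) : ℂ)))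
    (bound := fun θ => 8 * (1 + Real.cos θ) ^ (-(1 / 4) : ℝ) + 2 ^ (k + 1))
    (Metric.ball_mem_nhds (k : ℂ) (by norm_num : (0 : ℝ) < 1 / 8))
    (Eventually.of_forall fun s => ((hmeas2 s).mul hmeas3).aestronglyMeasurable)
    (intervalIntegrable_cosineMoment m (by rw [Complex.natCast_re]; linarith))
    (hmeas.mul ((hmeas2 _).mul hmeas3)).aestronglyMeasurable
    (ae_mem_uIoc_imp_Ioo fun θ hθ s hs => ?_) hb
    (ae_mem_uIoc_imp_Ioo fun θ hθ s hs => ?_)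
  · simp only [Complex.cpow_natCast] at key
    exact key
  · have hg := one_add_cos_pos hθ
    refine le_trans ?_ (abs_log_mul_rpow_le hg (by linarith [Real.cos_le_one θ]) (hball s hs))
    rw [norm_mul, norm_mul, Complex.norm_cpow_eq_rpow_re_of_pos hg, Complex.norm_real,
      Complex.norm_real, Real.norm_eq_abs, Real.norm_eq_abs]
    gcongr
    exact mul_le_of_le_one_right (Real.rpow_nonneg hg.le _) (Real.abs_cos_le_one _)
  · have hg := one_add_cos_pos hθ
    have hgc : ((1 + Real.cos θ : ℝ) : ℂ) ≠ 0 := by exact_mod_cast hg.ne'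
    have h := ((hasDerivAt_id s).const_cpow (c := ((1 + Real.cos θ : ℝ) : ℂ))
      (Or.inl hgc)).mul_const (Real.cos (m * θ) : ℂ)
    refine h.congr_deriv ?_
    rw [Complex.ofReal_log hg.le]
    simp only [id]
    ring

/-! ### Frobenius terms as moments -/

/-- The bridge from series to integral: Γ(k+s+1/2), 2^{k+s} and the two reciprocal Gammas are
exactly those in `cosineMoment_eq`, leaving 1/Γ(k+s+1). -/
theorem frobeniusTerm_add_eq (z : ℂ) (m k : ℕ) {s : ℂ} (hs : -(1 / 2) < s.re) :
    frobeniusTerm z m (k + m) s = Complex.exp ((k + s) * logNegI z) * rGamma (k + s + 1) *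
      cosineMoment m (k + s) / Real.pi := by
  have hre : -(1 / 2) < ((k : ℂ) + s).re := by
    simp only [Complex.add_re, Complex.natCast_re]
    linarith [(Nat.cast_nonneg k : (0 : ℝ) ≤ k)]
  have hΓ : Complex.Gamma (k + s + 1) ≠ 0 :=
    Complex.Gamma_ne_zero_of_re_pos (by rw [Complex.add_re, Complex.one_re]; linarith)
  have hpi : (Real.sqrt Real.pi : ℂ) * Real.sqrt Real.pi = Real.pi := by
    exact_mod_cast Real.mul_self_sqrt Real.pi_pos.le
  have hsq : (Real.sqrt Real.pi : ℂ) ≠ 0 := by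
    exact_mod_cast (Real.sqrt_pos.mpr Real.pi_pos).ne'
  have h2 : (2 : ℂ) ^ ((k : ℂ) + s) = Complex.exp ((k + s) * Real.log 2) := by
    rw [Complex.cpow_def_of_ne_zero two_ne_zero, mul_comm, Complex.ofReal_log two_pos.le]
    norm_num
  rw [cosineMoment_eq m hre, frobeniusTerm, hankelFactor, ← hpi, h2]
  push_cast
  rw [show (k : ℂ) + m - m + s = k + s by ring, show (k : ℂ) + m + s + 1 = k + s + m + 1 by ring,
    show (k : ℂ) + m + s - 2 * m + 1 = k + s - m + 1 by ring, mul_add, Complex.exp_add]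
  generalize rGamma (k + s + m + 1) = A, rGamma (k + s - m + 1) = B
  rw [rGamma]
  field_simp

theorem deriv_rGamma_nat_add_one (k : ℕ) : deriv rGamma (k + 1) =
    (Real.eulerMascheroniConstant - harmonic k) / k.factorial := by
  have h := (Complex.hasDerivAt_Gamma_nat k).inv (by
    rw [Complex.Gamma_nat_eq_factorial]; exact_mod_cast k.factorial_ne_zero)
  have e1 : (k.factorial : ℂ) ≠ 0 := by exact_mod_cast k.factorial_ne_zero
  have h' : HasDerivAt rGamma _ ((k : ℂ) + 1) := h
  rw [h'.deriv, Complex.Gamma_nat_eq_factorial]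
  field_simp
  ring

theorem frobeniusTerm_add_zero {z : ℂ} (hz : z ≠ 0) (m k : ℕ) :
    frobeniusTerm z m (k + m) 0 =
      (-Complex.I * z) ^ k / k.factorial * cosineMoment m k / Real.pi := by
  rw [frobeniusTerm_add_eq z m k (by norm_num), add_zero, rGamma_nat_add_one, Complex.exp_nat_mul,
    exp_logNegI hz]
  ring

theorem deriv_frobeniusTerm_add {z : ℂ} (hz : z ≠ 0) (m k : ℕ) :
    deriv (frobeniusTerm z m (k + m)) 0 = (-Complex.I * z) ^ k / k.factorial *
      ((logNegI z + Real.eulerMascheroniConstant - harmonic k) * cosineMoment m k +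
        ∫ θ in (0 : ℝ)..Real.pi, (Real.log (1 + Real.cos θ) : ℂ) *
          (((1 + Real.cos θ : ℝ) : ℂ) ^ k * (Real.cos (m * θ) : ℂ))) / Real.pi := by
  have hev : frobeniusTerm z m (k + m) =ᶠ[𝓝 0] fun s => Complex.exp ((k + s) * logNegI z) *
      rGamma (k + s + 1) * cosineMoment m (k + s) / Real.pi := by
    have : ∀ᶠ s : ℂ in 𝓝 0, -(1 / 2) < s.re :=
      Complex.continuous_re.continuousAt.eventually (lt_mem_nhds (by norm_num))
    filter_upwards [this] with s hs using frobeniusTerm_add_eq z m k hs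
  rw [hev.deriv_eq]
  have h1 : HasDerivAt (fun s : ℂ => Complex.exp ((k + s) * logNegI z))
      (Complex.exp ((k + 0) * logNegI z) * (1 * logNegI z)) 0 :=
    (((hasDerivAt_id (0 : ℂ)).const_add (k : ℂ)).mul_const _).cexp
  have h2 : HasDerivAt (fun s : ℂ => rGamma (k + s + 1)) (deriv rGamma (k + 1)) 0 := by
    have := HasDerivAt.comp (0 : ℂ) (differentiable_rGamma (k + 0 + 1)).hasDerivAt
      (((hasDerivAt_id (0 : ℂ)).const_add (k : ℂ)).add_const 1)
    simpa [Function.comp_def] using this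
  have h3 := HasDerivAt.comp_const_add (k : ℂ) 0
    (by rw [add_zero]; exact (hasDerivAt_cosineMoment m k).2)
  refine (((h1.mul h2).mul h3).div_const _).deriv.trans ?_
  simp only [Pi.mul_apply, add_zero]
  rw [deriv_rGamma_nat_add_one, rGamma_nat_add_one, Complex.exp_nat_mul, exp_logNegI hz]
  ring

/-! ### Expansion of the integrand and termwise integration -/

theorem exp_branch {z : ℂ} (hz : z ≠ 0) {θ : ℝ} (hθ : θ ∈ Set.Ioo 0 Real.pi) :
    Complex.exp (Complex.log z - Complex.I * (Real.pi / 2) + (Real.log (1 + Real.cos θ) : ℂ)) =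
      -Complex.I * z * ((1 + Real.cos θ : ℝ) : ℂ) := by
  have h := exp_logNegI hz
  rw [logNegI] at h
  rw [Complex.exp_add, h, ← Complex.ofReal_exp, Real.exp_log (one_add_cos_pos hθ)]

/-- Subtracting iπ/2 cancels the rotation of the argument by -π/2, so that only the principal log z
remains. -/
theorem gammaZeroBranch_eq {z : ℂ} (hz : z ≠ 0) {θ : ℝ} (hθ : θ ∈ Set.Ioo 0 Real.pi) :
    gammaZeroBranch z θ - Complex.I * (Real.pi / 2) =
      -Real.eulerMascheroniConstant - Complex.log z - Real.log (1 + Real.cos θ) +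
        einIntegral (-Complex.I * z * ((1 + Real.cos θ : ℝ) : ℂ)) := by
  rw [gammaZeroBranch, upperGammaOfLog_zero_expansion, exp_branch hz hθ]
  ring

theorem gammaZeroBranch_eq_upperGamma {z : ℂ} (hz : z ≠ 0) (harg : -(Real.pi / 2) < Complex.arg z)
    {θ : ℝ} (hθ : θ ∈ Set.Ioo 0 Real.pi) :
    gammaZeroBranch z θ = upperGamma 0 (-Complex.I * z * (1 + Real.cos θ)) := by
  have him : (Complex.log z - Complex.I * (Real.pi / 2) +
      (Real.log (1 + Real.cos θ) : ℂ)).im = Complex.arg z - Real.pi / 2 := by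
    rw [show Complex.I * ((Real.pi : ℂ) / 2) = ((Real.pi / 2 : ℝ) : ℂ) * Complex.I by
      push_cast; ring]
    simp only [Complex.add_im, Complex.sub_im, Complex.log_im, Complex.im_ofReal_mul,
      Complex.I_im, Complex.ofReal_im, mul_one, add_zero]
  rw [gammaZeroBranch, upperGammaOfLog_zero_eq, exp_branch hz hθ]
  · push_cast
    rfl
  · rw [him]; linarith
  · rw [him]; linarith [Complex.arg_le_pi z, Real.pi_pos]

/-- With w = -iz(1 + cos θ), e^{-iz cos θ} = e^{iz} e^w, and e^w cancels the e^{-w} in the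
complementary exponential integral. -/
theorem hasSum_branch_integrand {z : ℂ} (hz : z ≠ 0) (m : ℕ) {θ : ℝ}
    (hθ : θ ∈ Set.Ioo 0 Real.pi) :
    HasSum (fun k : ℕ => Complex.exp (Complex.I * z) * ((-Complex.I * z) ^ k / k.factorial) *
      ((harmonic k - Real.eulerMascheroniConstant - Complex.log z) *
          (((1 + Real.cos θ : ℝ) : ℂ) ^ k * (Real.cos (m * θ) : ℂ)) -
        (Real.log (1 + Real.cos θ) : ℂ) *
          (((1 + Real.cos θ : ℝ) : ℂ) ^ k * (Real.cos (m * θ) : ℂ))))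
      (Complex.exp (-Complex.I * z * Real.cos θ) *
        (gammaZeroBranch z θ - Complex.I * (Real.pi / 2)) * (Real.cos (m * θ) : ℂ)) := by
  set w := -Complex.I * z * ((1 + Real.cos θ : ℝ) : ℂ) with hw
  have h1 : HasSum (fun k : ℕ => w ^ k / k.factorial) (Complex.exp w) := by
    rw [Complex.exp_eq_exp_ℂ]
    exact NormedSpace.expSeries_div_hasSum_exp w
  have h2 : HasSum (fun k : ℕ => (harmonic k : ℂ) * w ^ k / k.factorial) (harmonicExp w) :=
    (harmonicExp_spec w).1.hasSum
  have h3 := (h2.add (h1.mul_left (-Real.eulerMascheroniConstant - Complex.log z -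
    Real.log (1 + Real.cos θ) : ℂ))).mul_left
      (Complex.exp (Complex.I * z) * (Real.cos (m * θ) : ℂ))
  have hexp : Complex.exp (-Complex.I * z * Real.cos θ) =
      Complex.exp (Complex.I * z) * Complex.exp w := by
    rw [← Complex.exp_add, hw]
    push_cast
    ring_nf
  have hinv : Complex.exp w * Complex.exp (-w) = 1 := by rw [← Complex.exp_add]; simp
  have hval : Complex.exp (-Complex.I * z * Real.cos θ) *
      (gammaZeroBranch z θ - Complex.I * (Real.pi / 2)) * (Real.cos (m * θ) : ℂ) =
      Complex.exp (Complex.I * z) * (Real.cos (m * θ) : ℂ) * (harmonicExp w +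
        (-Real.eulerMascheroniConstant - Complex.log z - Real.log (1 + Real.cos θ)) *
          Complex.exp w) := by
    rw [gammaZeroBranch_eq hz hθ, ← hw, hexp, einIntegral]
    linear_combination (Complex.exp (Complex.I * z) * harmonicExp w *
      (Real.cos (m * θ) : ℂ)) * hinv
  rw [hval]
  refine h3.congr_fun fun k => ?_
  rw [hw, mul_pow _ (((1 + Real.cos θ : ℝ) : ℂ))]
  ring

theorem intervalIntegrable_log_one_add_cos :
    IntervalIntegrable (fun θ : ℝ => (Real.log (1 + Real.cos θ) : ℂ))
      MeasureTheory.volume 0 Real.pi := by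
  simpa using (hasDerivAt_cosineMoment 0 0).1

theorem intervalIntegrable_branch_integrand {z : ℂ} (hz : z ≠ 0) (m : ℕ) :
    IntervalIntegrable (fun θ : ℝ => Complex.exp (-Complex.I * z * Real.cos θ) *
        (gammaZeroBranch z θ - Complex.I * (Real.pi / 2)) * (Real.cos (m * θ) : ℂ))
      MeasureTheory.volume 0 Real.pi := by
  have hein : Continuous einIntegral :=
    continuous_iff_continuousAt.mpr fun w => (hasDerivAt_einIntegral w).1.continuousAt
  have h1 : IntervalIntegrable (fun θ : ℝ => Complex.exp (-Complex.I * z * Real.cos θ) *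
      (-Real.eulerMascheroniConstant - Complex.log z +
        einIntegral (-Complex.I * z * ((1 + Real.cos θ : ℝ) : ℂ))) * (Real.cos (m * θ) : ℂ))
      MeasureTheory.volume 0 Real.pi :=
    Continuous.intervalIntegrable (by fun_prop) _ _
  have h2 : IntervalIntegrable (fun θ : ℝ => (Real.log (1 + Real.cos θ) : ℂ) *
      (Complex.exp (-Complex.I * z * Real.cos θ) * (Real.cos (m * θ) : ℂ)))
      MeasureTheory.volume 0 Real.pi :=
    intervalIntegrable_log_one_add_cos.mul_continuousOn (by fun_prop)
  refine (h1.sub h2).congr_ae ?_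
  rw [EventuallyEq, MeasureTheory.ae_restrict_iff' measurableSet_uIoc]
  refine ae_mem_uIoc_imp_Ioo fun θ hθ => ?_
  rw [gammaZeroBranch_eq hz hθ]
  ring

/-- The multiple iπ/2 of the undifferentiated term replaces log(-iz) by log z in the differentiated
one. -/
theorem integral_branch_term {z : ℂ} (hz : z ≠ 0) (m k : ℕ) :
    ∫ θ in (0 : ℝ)..Real.pi, Complex.exp (Complex.I * z) *
      ((-Complex.I * z) ^ k / k.factorial) *
      ((harmonic k - Real.eulerMascheroniConstant - Complex.log z) *
          (((1 + Real.cos θ : ℝ) : ℂ) ^ k * (Real.cos (m * θ) : ℂ)) -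
        (Real.log (1 + Real.cos θ) : ℂ) *
          (((1 + Real.cos θ : ℝ) : ℂ) ^ k * (Real.cos (m * θ) : ℂ))) =
      -(Real.pi * Complex.exp (Complex.I * z)) * (deriv (frobeniusTerm z m (k + m)) 0 +
        Complex.I * (Real.pi / 2) * frobeniusTerm z m (k + m) 0) := by
  have hπ : (Real.pi : ℂ) ≠ 0 := by exact_mod_cast Real.pi_ne_zero
  have hI1 := intervalIntegrable_cosineMoment m (s := k) (by
    rw [Complex.natCast_re]; linarith [(Nat.cast_nonneg k : (0 : ℝ) ≤ k)])
  simp only [Complex.cpow_natCast] at hI1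
  have hI2 := (hasDerivAt_cosineMoment m k).1
  rw [intervalIntegral.integral_const_mul, intervalIntegral.integral_sub (hI1.const_mul _) hI2,
    intervalIntegral.integral_const_mul, deriv_frobeniusTerm_add hz, frobeniusTerm_add_zero hz,
    cosineMoment, logNegI]
  simp only [Complex.cpow_natCast]
  field_simp
  ring

theorem hasSum_integral_branch {z : ℂ} (hz : z ≠ 0) (m : ℕ) :
    HasSum (fun k : ℕ => -(Real.pi * Complex.exp (Complex.I * z)) *
        (deriv (frobeniusTerm z m (k + m)) 0 +
          Complex.I * (Real.pi / 2) * frobeniusTerm z m (k + m) 0))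
      (∫ θ in (0 : ℝ)..Real.pi, Complex.exp (-Complex.I * z * Real.cos θ) *
        (gammaZeroBranch z θ - Complex.I * (Real.pi / 2)) * (Real.cos (m * θ) : ℂ)) := by
  simp only [← integral_branch_term hz]
  set C := ‖(Real.eulerMascheroniConstant : ℂ) + Complex.log z‖ with hC
  -- Both H_k and (1 + cos θ)^k are at most 2^k, whence 4‖z‖; the constants γ + log z meet only the
  -- second bound, whence 2‖z‖. The logarithm is carried by a separate θ-factor.
  set u : ℕ → ℝ := fun k => ‖Complex.exp (Complex.I * z)‖ *
    ((4 * ‖z‖) ^ k / k.factorial + (C + 1) * ((2 * ‖z‖) ^ k / k.factorial)) with hu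
  have hus : Summable u :=
    ((Real.summable_pow_div_factorial _).add
      ((Real.summable_pow_div_factorial _).mul_left _)).mul_left _
  have hlog := intervalIntegrable_log_one_add_cos
  have hmeas : Measurable fun θ : ℝ => (Real.log (1 + Real.cos θ) : ℂ) :=
    Complex.measurable_ofReal.comp (Real.measurable_log.comp (by fun_prop))
  have hmeas2 : ∀ k : ℕ, Measurable fun θ : ℝ =>
      ((1 + Real.cos θ : ℝ) : ℂ) ^ k * (Real.cos (m * θ) : ℂ) := fun k =>
    Continuous.measurable (by fun_prop)
  refine intervalIntegral.hasSum_integral_of_dominated_convergence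
    (fun k θ => u k * (1 + |Real.log (1 + Real.cos θ)|)) (fun k => ?_)
    (fun k => ae_mem_uIoc_imp_Ioo fun θ hθ => ?_)
    (Eventually.of_forall fun θ _ => hus.mul_right _) ?_
    (ae_mem_uIoc_imp_Ioo fun θ hθ => hasSum_branch_integrand hz m hθ)
  · exact ((((hmeas2 k).const_mul _).sub (hmeas.mul (hmeas2 k))).const_mul _).aestronglyMeasurable
  · have hg := one_add_cos_pos hθ
    set l := Real.log (1 + Real.cos θ) with hl
    have e1 : ‖((1 + Real.cos θ : ℝ) : ℂ) ^ k * (Real.cos (m * θ) : ℂ)‖ ≤ 2 ^ k := by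
      rw [norm_mul, norm_pow, Complex.norm_real, Complex.norm_real, Real.norm_eq_abs,
        Real.norm_eq_abs, abs_of_pos hg]
      have h1 : (1 + Real.cos θ) ^ k ≤ 2 ^ k :=
        pow_le_pow_left₀ hg.le (by linarith [Real.cos_le_one θ]) k
      exact (mul_le_of_le_one_right (by positivity) (Real.abs_cos_le_one _)).trans h1
    have e2 : ‖(harmonic k : ℂ) - Real.eulerMascheroniConstant - Complex.log z - l‖ ≤
        (2 ^ k + (C + 1)) * (1 + |l|) := by
      have h1 : ‖(harmonic k : ℂ)‖ ≤ 2 ^ k :=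
        (norm_harmonic_le k).trans (by exact_mod_cast Nat.lt_two_pow_self.le)
      have h2 : ‖(harmonic k : ℂ) - Real.eulerMascheroniConstant - Complex.log z - l‖ ≤
          ‖(harmonic k : ℂ)‖ + C + |l| := by
        rw [sub_sub (harmonic k : ℂ)]
        refine (norm_sub_le _ _).trans ?_
        rw [Complex.norm_real, Real.norm_eq_abs]
        gcongr
        exact norm_sub_le _ _
      have h3 : (0 : ℝ) ≤ 2 ^ k := by positivity
      have h4 : 0 ≤ C := norm_nonneg _
      nlinarith [mul_nonneg h3 (abs_nonneg l), mul_nonneg h4 (abs_nonneg l)]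
    rw [← sub_mul, norm_mul, norm_mul, norm_mul, norm_div, norm_pow, norm_mul, norm_neg,
      Complex.norm_I, one_mul, Complex.norm_natCast]
    calc _ ≤ ‖Complex.exp (Complex.I * z)‖ * (‖z‖ ^ k / k.factorial) *
          ((2 ^ k + (C + 1)) * (1 + |l|) * 2 ^ k) := by gcongr
      _ = _ := by
        simp only [hu]
        rw [mul_pow, mul_pow, show (4 : ℝ) = 2 * 2 by norm_num, mul_pow]
        ring
  · simp only [tsum_mul_right]
    refine IntervalIntegrable.const_mul ?_ _
    refine IntervalIntegrable.add (by simp) ?_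
    refine hlog.norm.congr_ae (Eventually.of_forall fun θ => ?_)
    simp only [Complex.norm_real, Real.norm_eq_abs]

/-! ### The finite sum and assembly -/

/-- The reciprocal of the residue of Γ at -n, obtained by differentiating 1/Γ(x) = x/Γ(x+1) and
descending. -/
theorem deriv_rGamma_neg_nat (n : ℕ) : deriv rGamma (-n) = (-1) ^ n * n.factorial := by
  have hrec : ∀ x : ℂ, deriv rGamma x = rGamma (x + 1) + x * deriv rGamma (x + 1) := by
    intro x
    have h1 : HasDerivAt (fun x : ℂ => x * rGamma (x + 1))
        (1 * rGamma (x + 1) + x * deriv rGamma (x + 1)) x :=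
      (hasDerivAt_id x).mul
        (HasDerivAt.comp_add_const x 1 (differentiable_rGamma (x + 1)).hasDerivAt)
    rw [← funext rGamma_eq_mul] at h1
    rw [h1.deriv, one_mul]
  induction n with
  | zero =>
    rw [hrec]
    simp [rGamma]
  | succ n ih =>
    rw [hrec]
    push_cast
    rw [show -((n : ℂ) + 1) + 1 = -n by ring, ih, rGamma_neg_nat, Nat.factorial_succ]
    push_cast
    ring

/-- For n < m the factor 1/Γ(n - 2m + 1) has a simple zero, so only its derivative contributes. The
indices correspond by j = m - n. -/
theorem neumannSum_natCast {z : ℂ} (hz : z ≠ 0) (m : ℕ) :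
    neumannSum m z = -Complex.exp (Complex.I * z) *
      ∑ n ∈ Finset.range m, deriv (frobeniusTerm z m n) 0 := by
  rw [neumannSum, Int.natAbs_natCast, zpow_natCast, ← Finset.sum_range_reflect, Finset.range_eq_Ico,
    Finset.sum_Ico_eq_sum_range, Finset.mul_sum, Finset.mul_sum]
  have hIcc : Finset.Icc 1 m = (Finset.range (m - 0)).image (fun i => i + 1) := by
    ext j
    simp only [Finset.mem_Icc, Finset.mem_image, Finset.mem_range]
    constructor
    · rintro ⟨h1, h2⟩
      exact ⟨j - 1, by omega, by omega⟩
    · rintro ⟨i, hi, rfl⟩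
      omega
  rw [hIcc, Finset.sum_image (fun a _ b _ h => by simpa using h)]
  refine Finset.sum_congr rfl fun i hi => ?_
  rw [Finset.mem_range] at hi
  -- Here i + 1 is the index j of the finite sum and c = m - j the index of the Frobenius term.
  obtain ⟨c, rfl⟩ : ∃ c, m = i + 1 + c := ⟨m - (i + 1), by omega⟩
  have hidx : i + 1 + c - 1 - (0 + i) = c := by omega
  rw [hidx, deriv_frobeniusTerm_zero]
  have hr0 : rGamma ((c : ℂ) - 2 * (i + 1 + c : ℕ) + 1) = 0 := by
    have := rGamma_neg_nat (2 * i + 1 + c)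
    push_cast at this ⊢
    rwa [show (c : ℂ) - 2 * (i + 1 + c) + 1 = -(2 * i + 1 + c) by ring]
  have hr1 : deriv rGamma ((c : ℂ) - 2 * (i + 1 + c : ℕ) + 1) =
      (-1) ^ (2 * i + 1 + c) * (2 * i + 1 + c).factorial := by
    have := deriv_rGamma_neg_nat (2 * i + 1 + c)
    push_cast at this ⊢
    rwa [show (c : ℂ) - 2 * (i + 1 + c) + 1 = -(2 * i + 1 + c) by ring]
  have hG1 : Complex.Gamma (((i + 1 : ℕ) : ℂ) + (i + 1 + c : ℕ)) = (2 * i + 1 + c).factorial := by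
    rw [← Complex.Gamma_nat_eq_factorial]
    push_cast
    ring_nf
  have hG2 : Complex.Gamma (((i + 1 + c : ℕ) : ℂ) - (i + 1 : ℕ) + 1) = c.factorial := by
    rw [← Complex.Gamma_nat_eq_factorial]
    push_cast
    ring_nf
  have hpow : Complex.exp (((c : ℂ) - (i + 1 + c : ℕ)) * (logNegI z + Real.log 2)) =
      (-1) ^ (i + 1) * (2 * Complex.I * z) ^ (-((i + 1 : ℕ) : ℤ)) := by
    rw [show ((c : ℂ) - (i + 1 + c : ℕ)) = ((-((i + 1 : ℕ) : ℤ) : ℤ) : ℂ) by push_cast; ring,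
      Complex.exp_int_mul, exp_two_log_add hz,
      show -Complex.I * z * 2 = -1 * (2 * Complex.I * z) by ring, mul_zpow, zpow_neg (-1 : ℂ),
      ← inv_zpow, zpow_natCast]
    norm_num
  have hsgn : ((-1 : ℂ) ^ (i + 1)) * (-1) ^ (2 * i + 1 + c) = -(-1) ^ (i + 1 + c) := by
    rw [← pow_add, show i + 1 + (2 * i + 1 + c) = 2 * i + 1 + (i + 1 + c) by ring, pow_add,
      pow_add _ (2 * i), pow_mul]
    norm_num
  rw [hr0, hr1, hG1, hG2, rGamma_nat_add_one, hankelFactor, hpow,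
    show ((c : ℂ) - (i + 1 + c : ℕ)) + 1 / 2 = 1 / 2 - ((i + 1 : ℕ) : ℂ) by push_cast; ring]
  generalize (2 * Complex.I * z) ^ (-((i + 1 : ℕ) : ℤ)) = P
  generalize Complex.Gamma (1 / 2 - ((i + 1 : ℕ) : ℂ)) = G
  rw [mul_zero, mul_zero, zero_add, zero_add]
  linear_combination (Complex.exp (Complex.I * z) * P * G / (Real.sqrt Real.pi : ℂ) *
    (c.factorial : ℂ)⁻¹ * ((2 * i + 1 + c).factorial : ℂ)) * hsgn

theorem frobeniusTerm_zero_eq (z : ℂ) (m n : ℕ) :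
    frobeniusTerm z m n 0 = kummerTerm z n (-m) := by
  rw [frobeniusTerm, kummerTerm, add_zero, add_zero, ← sub_eq_add_neg,
    show (n : ℂ) + 2 * -m + 1 = n - 2 * m + 1 by ring]

/-- The Frobenius series is cut at n = m: the tail integrates to the Γ(0, ·) integral, the head is
the finite sum. The undifferentiated head vanishes, so the tail alone carries the Kummer sum. -/
theorem besselY_natCast {z : ℂ} (hz : z ≠ 0) (m : ℕ) :
    besselY m z = -(2 * Complex.I ^ m / Real.pi) *
      (1 / Real.pi * (∫ θ in (0 : ℝ)..Real.pi, Complex.exp (-Complex.I * z * Real.cos θ) *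
        (gammaZeroBranch z θ - Complex.I * (Real.pi / 2)) * (Real.cos (m * θ) : ℂ)) +
          neumannSum m z) := by
  have hπ : (Real.pi : ℂ) ≠ 0 := by exact_mod_cast Real.pi_ne_zero
  obtain ⟨hf, hd⟩ := hasSum_deriv_frobeniusTerm hz m
  have hd' := hd.summable
  have hf' := hf.of_norm
  have hsplit := hd'.sum_add_tsum_nat_add m
  have hK : ∑' k, frobeniusTerm z m (k + m) 0 = kummerSum z m := by
    rw [← kummerSum_neg hz, kummerSum]
    have h := hf'.sum_add_tsum_nat_add m
    rw [Finset.sum_eq_zero (fun n hn => by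
      rw [frobeniusTerm_zero_eq, kummerTerm_neg_of_lt]
      have := Finset.mem_range.mp hn
      omega), zero_add] at h
    rw [h]
    exact tsum_congr fun n => frobeniusTerm_zero_eq z m n
  rw [← (hasSum_integral_branch hz m).tsum_eq, tsum_mul_left,
    ((summable_nat_add_iff m).mpr hd').tsum_add (((summable_nat_add_iff m).mpr hf').mul_left _),
    tsum_mul_left, hK, neumannSum_natCast hz, besselY_eq_tsum_deriv_frobeniusTerm hz, ← hsplit]
  field_simp
  ring

theorem neumannSum_neg (m : ℤ) (z : ℂ) : neumannSum (-m) z = neumannSum m z := by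
  rw [neumannSum, neumannSum, Int.natAbs_neg, zpow_neg, ← inv_zpow]
  norm_num

/-- The integral representation of `Y_m` for integer order. -/
theorem besselY_intCast {z : ℂ} (hz : z ≠ 0) (m : ℤ) :
    IntervalIntegrable (fun θ : ℝ => Complex.exp (-Complex.I * z * Real.cos θ) *
        (gammaZeroBranch z θ - Complex.I * (Real.pi / 2)) * (Real.cos (m * θ) : ℂ))
      MeasureTheory.volume 0 Real.pi ∧
    besselY m z = -(2 * Complex.I ^ m / Real.pi) *
      (1 / Real.pi * (∫ θ in (0 : ℝ)..Real.pi, Complex.exp (-Complex.I * z * Real.cos θ) *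
        (gammaZeroBranch z θ - Complex.I * (Real.pi / 2)) * (Real.cos (m * θ) : ℂ)) +
          neumannSum m z) := by
  obtain ⟨n, rfl | rfl⟩ := m.eq_nat_or_neg
  · have h1 := intervalIntegrable_branch_integrand hz n
    have h2 := besselY_natCast hz n
    simp only [Int.cast_natCast, zpow_natCast]
    exact ⟨h1, h2⟩
  · have h1 := intervalIntegrable_branch_integrand hz n
    have h2 := besselY_natCast hz n
    -- On both sides, passing from n to -n multiplies by (-1)^n: the factor comes from reflection on
    -- the left and from i^{-n} on the right, the bracket being even in the order.
    have h3 := besselY_neg_int hz n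
    have hcos : ∀ θ : ℝ, Real.cos (((-(n : ℤ) : ℤ) : ℝ) * θ) = Real.cos (n * θ) := fun θ => by
      push_cast
      rw [neg_mul, Real.cos_neg]
    have hI : Complex.I ^ (-(n : ℤ)) = (-1) ^ n * Complex.I ^ n := by
      rw [zpow_neg, ← inv_zpow, Complex.inv_I, zpow_natCast, ← mul_pow]
      norm_num
    rw [Int.cast_natCast, zpow_natCast] at h3
    simp only [hcos]
    refine ⟨h1, ?_⟩
    rw [h3, h2, neumannSum_neg, hI]
    ring

end

theorem mainTheorem4 (m : ℤ) (z : ℂ) (hz : z ≠ 0) :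
    -- the limit defining `Y_m(z)` exists
    Tendsto (fun μ : ℂ => besselY μ z) (𝓝[≠] (m : ℂ)) (𝓝 (besselY m z)) ∧
    -- the representation, with the branch `arg (-iz(1 + cos θ)) = arg z - π/2` of `Γ(0, ·)`
    (IntervalIntegrable
        (fun θ : ℝ => Complex.exp (-Complex.I * z * Real.cos θ) *
          (gammaZeroBranch z θ - Complex.I * (Real.pi / 2)) * (Real.cos (m * θ) : ℂ))
        MeasureTheory.volume 0 Real.pi ∧
      besselY m z =
        -(2 * Complex.I ^ m / Real.pi) *
          (1 / Real.pi * (∫ θ in (0 : ℝ)..Real.pi,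
              Complex.exp (-Complex.I * z * Real.cos θ) *
                (gammaZeroBranch z θ - Complex.I * (Real.pi / 2)) * (Real.cos (m * θ) : ℂ)) +
            neumannSum m z)) ∧
    -- the representation with the principal branch of `Γ(0, ·)`
    (-(Real.pi / 2) < Complex.arg z →
      IntervalIntegrable
        (fun θ : ℝ => Complex.exp (-Complex.I * z * Real.cos θ) *
          (upperGamma 0 (-Complex.I * z * (1 + Real.cos θ)) - Complex.I * (Real.pi / 2)) *
            (Real.cos (m * θ) : ℂ))
        MeasureTheory.volume 0 Real.pi ∧
      besselY m z =
        -(2 * Complex.I ^ m / Real.pi) *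
          (1 / Real.pi * (∫ θ in (0 : ℝ)..Real.pi,
              Complex.exp (-Complex.I * z * Real.cos θ) *
                (upperGamma 0 (-Complex.I * z * (1 + Real.cos θ)) - Complex.I * (Real.pi / 2)) *
                  (Real.cos (m * θ) : ℂ)) +
            neumannSum m z)) ∧
    -- the case `m = 0`, with both branches
    besselY 0 z =
      2 / (Real.pi : ℂ) ^ 2 * (∫ θ in (0 : ℝ)..Real.pi,
        Complex.exp (-Complex.I * z * Real.cos θ) *
          (Complex.I * (Real.pi / 2) - gammaZeroBranch z θ)) ∧
    (-(Real.pi / 2) < Complex.arg z →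
      besselY 0 z =
        2 / (Real.pi : ℂ) ^ 2 * (∫ θ in (0 : ℝ)..Real.pi,
          Complex.exp (-Complex.I * z * Real.cos θ) *
            (Complex.I * (Real.pi / 2) -
              upperGamma 0 (-Complex.I * z * (1 + Real.cos θ))))) := by
  have hY0 := besselY_intCast hz 0
  -- The continued and principal branches are compared only on the open interval (0, π), which
  -- suffices up to a null set for integrability and for the integrals.
  have hcongr : -(Real.pi / 2) < Complex.arg z → ∀ f : ℂ → ℝ → ℂ,
      ∀ᵐ θ : ℝ, θ ∈ Set.uIoc 0 Real.pi → f (gammaZeroBranch z θ) θ =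
        f (upperGamma 0 (-Complex.I * z * (1 + Real.cos θ))) θ := fun harg f =>
    ae_mem_uIoc_imp_Ioo fun θ hθ => by rw [gammaZeroBranch_eq_upperGamma hz harg hθ]
  have hzero : besselY 0 z = 2 / (Real.pi : ℂ) ^ 2 * (∫ θ in (0 : ℝ)..Real.pi,
      Complex.exp (-Complex.I * z * Real.cos θ) *
        (Complex.I * (Real.pi / 2) - gammaZeroBranch z θ)) := by
    have h := hY0.2
    simp only [Int.cast_zero, zero_mul, Real.cos_zero, Complex.ofReal_one, mul_one, zpow_zero] at h
    have hσ : neumannSum 0 z = 0 := by simp [neumannSum]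
    rw [h, hσ, ← intervalIntegral.integral_const_mul (2 / (Real.pi : ℂ) ^ 2), add_zero, ← mul_assoc,
      ← intervalIntegral.integral_const_mul]
    refine intervalIntegral.integral_congr fun θ _ => ?_
    have hπ : (Real.pi : ℂ) ≠ 0 := by exact_mod_cast Real.pi_ne_zero
    field_simp
    ring
  have hm := besselY_intCast hz m
  refine ⟨tendsto_besselY hz m, hm, fun harg => ⟨?_, ?_⟩, hzero, fun harg => ?_⟩
  · refine hm.1.congr_ae ?_
    rw [EventuallyEq, MeasureTheory.ae_restrict_iff' measurableSet_uIoc]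
    exact hcongr harg fun g θ => Complex.exp (-Complex.I * z * Real.cos θ) *
      (g - Complex.I * (Real.pi / 2)) * (Real.cos (m * θ) : ℂ)
  · rw [hm.2, intervalIntegral.integral_congr_ae (hcongr harg fun g θ =>
      Complex.exp (-Complex.I * z * Real.cos θ) *
        (g - Complex.I * (Real.pi / 2)) * (Real.cos (m * θ) : ℂ))]
  · rw [hzero, intervalIntegral.integral_congr_ae (hcongr harg fun g θ =>
      Complex.exp (-Complex.I * z * Real.cos θ) * (Complex.I * (Real.pi / 2) - g))]
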